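/- Let $X_1, X_2, \ldots$ be an infinite sequence of independent random variables on a probability space, each having the standard Cauchy distribution (density $\frac{1}{\pi(1+x^2)}$ on $\mathbb{R}$, equivalently characteristic function $\varphi(t)=e^{-|t|}$), and let $S_n = X_1+\cdots+X_n$. Let $\zeta$ denote the Riemann zeta function. Then $\zeta(\tfrac12+iS_n)$ is square integrable for every $n$, $$\mathbb{E}\,\bigl|\zeta(\tfrac12+iS_n)\bigr|^2 = \mathcal{O}(\log n), \qquad n\to\infty,$$ and $$\mathbb{E}\,\bigl|\zeta(\tfrac12+iS_{n+2})-\zeta(\tfrac12+iS_n)\bigr|^2 = 2\log n + o\bigl(\sqrt{\log n}\bigr), \qquad n\to\infty.$$ -/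

import Mathlib

open MeasureTheory ProbabilityTheory Filter Asymptotics

/-- The random walk `S n = X 0 + ⋯ + X (n - 1)`, the sum of the first `n` terms of the
sequence `X`. -/
def randomWalk {Ω : Type*} (X : ℕ → Ω → ℝ) (n : ℕ) (ω : Ω) : ℝ :=
  ∑ i ∈ Finset.range n, X i ω

/-- The Riemann zeta function on the critical line, `t ↦ ζ(1/2 + i t)`. -/
noncomputable def zetaHalf (t : ℝ) : ℂ :=
  riemannZeta (1 / 2 + Complex.I * (t : ℂ))

/-!
The point `S_n` has the Cauchy law of scale `n`, so `𝔼 x^{-i S_n} y^{i S_n} = min(x/y, y/x)^n`.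
On the critical line `ζ(1/2 + it)` is the limit of its truncations
`A_N(t) = ∑_{k ≤ N} k^{-1/2-it} - ∫₀^N x^{-1/2-it} dx`, that is, of the Mellin transforms of the
signed measure `ν = ∑ δ_k - dx` restricted to `(0, N]`. By Fubini every second moment of such
truncations along the walk is a double integral over `ν ⊗ ν` of an explicit positive kernel
(`integral_mellinHalf_sub_mul_conj`), and three such integrals give the theorem.

* Truncation error. At scale `1/2` the kernel `(xy)^{-1/2} min(x/y, y/x)^{1/2}` equals
  `1 / max(x, y) = ∫ 1_{x ≤ z} 1_{y ≤ z} z⁻² dz`, so that the mean square of `A_b - A_a` is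
  `∫_a^∞ ν((a, min(z, b)])² z⁻² dz ≤ 1 / a`. The Cauchy density of scale `n` is at most `2n` times
  that of scale `1/2`. With Fatou's lemma, `ζ(1/2 + iS_n)` is within `√(2n/N)` of `A_N(S_n)` in `L²`
  (`lintegral_zetaHalf_sub_zetaBlock_le`); in particular it is square integrable.
* Mean square. The kernel of exponent `n` concentrates near the diagonal, where it gives the
  harmonic sum up to `N`; all other contributions are bounded in terms of `N / n`
  (`exists_abs_integral_norm_zetaBlock_sub_le`). For `N = nL` the mean square of `A_N(S_n)` is thus
  `log n + O_L(1)`, hence that of `ζ(1/2 + iS_n)` is `log n + O(√(log n / L)) + O_L(1)`; as `L` is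
  arbitrary, it is `log n + o(√(log n))`.
* Correlation. Two further steps of the walk bring in the factor `min(x, 1/x)²`. Then the kernel is
  dominated by `φ(x) φ(y)` with `φ(x) = x^{-1/2} min(1, 1/x)`, which is integrable with respect to
  the total variation of `ν`. So the correlation of the values of the zeta function at the times `n`
  and `n + 2` is bounded (`exists_norm_inner_zetaVec_le`), and the mean square of the increment is
  the sum of the two mean squares up to a bounded error.
-/

open scoped FourierTransform NNReal ENNReal Topology ComplexConjugate

/-! ### Characteristic functions of the Cauchy law and of the walk -/

lemma integrable_exp_neg_mul_abs {c : ℝ} (hc : 0 < c) :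
    Integrable (fun u : ℝ => (Real.exp (-c * |u|) : ℂ)) := by
  suffices h : Integrable (fun u : ℝ => Real.exp (-c * |u|)) from h.ofReal
  rw [← integrableOn_univ, ← Set.Iic_union_Ioi (a := (0 : ℝ)), integrableOn_union]
  constructor
  · refine (integrableOn_exp_mul_Iic hc 0).congr_fun ?_ measurableSet_Iic
    intro u hu
    simp only [abs_of_nonpos (Set.mem_Iic.mp hu)]
    ring_nf
  · refine (integrableOn_exp_mul_Ioi (neg_lt_zero.mpr hc) 0).congr_fun ?_ measurableSet_Ioi
    intro u hu
    simp only [abs_of_pos (Set.mem_Ioi.mp hu)]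

/-- The Cauchy density is the Fourier transform of a two-sided exponential. -/
lemma fourier_exp_neg_abs {γ : ℝ≥0} (hγ : γ ≠ 0) (w : ℝ) :
    𝓕 (fun u : ℝ => (Real.exp (-(2 * Real.pi * γ) * |u|) : ℂ)) w = (cauchyPDFReal 0 γ w : ℂ) := by
  have hγ' : (0 : ℝ) < γ := by positivity
  have hc : 0 < 2 * Real.pi * (γ : ℝ) := by positivity
  have key : ∀ u : ℝ, Complex.exp (((-2 * Real.pi * u * w : ℝ) : ℂ) * Complex.I) •
      (Real.exp (-(2 * Real.pi * γ) * |u|) : ℂ) =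
      Complex.exp (((-2 * Real.pi * u * w : ℝ) : ℂ) * Complex.I +
        ((-(2 * Real.pi * γ) * |u| : ℝ) : ℂ)) := by
    intro u
    rw [Complex.exp_add, smul_eq_mul, Complex.ofReal_exp]
  have hint : Integrable (fun u : ℝ => Complex.exp (((-2 * Real.pi * u * w : ℝ) : ℂ) * Complex.I) •
      (Real.exp (-(2 * Real.pi * γ) * |u|) : ℂ)) := by
    refine (integrable_exp_neg_mul_abs hc).norm.mono' (by fun_prop) (.of_forall fun u => ?_)
    rw [norm_smul, Complex.norm_exp_ofReal_mul_I, one_mul]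
  rw [Real.fourier_real_eq_integral_exp_smul,
    ← intervalIntegral.integral_Iic_add_Ioi (b := 0) hint.integrableOn hint.integrableOn]
  have h1 : ∫ u in Set.Iic (0 : ℝ), Complex.exp (((-2 * Real.pi * u * w : ℝ) : ℂ) * Complex.I) •
      (Real.exp (-(2 * Real.pi * γ) * |u|) : ℂ) =
      ∫ u in Set.Iic (0 : ℝ), Complex.exp ((2 * Real.pi * (γ - w * Complex.I)) * u) := by
    refine setIntegral_congr_fun measurableSet_Iic fun u hu => ?_
    rw [key, abs_of_nonpos (Set.mem_Iic.mp hu)]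
    congr 1
    push_cast
    ring
  have h2 : ∫ u in Set.Ioi (0 : ℝ), Complex.exp (((-2 * Real.pi * u * w : ℝ) : ℂ) * Complex.I) •
      (Real.exp (-(2 * Real.pi * γ) * |u|) : ℂ) =
      ∫ u in Set.Ioi (0 : ℝ), Complex.exp ((-2 * Real.pi * (γ + w * Complex.I)) * u) := by
    refine setIntegral_congr_fun measurableSet_Ioi fun u hu => ?_
    rw [key, abs_of_pos (Set.mem_Ioi.mp hu)]
    congr 1
    push_cast
    ring
  have e1 : (γ : ℂ) - w * Complex.I ≠ 0 := by
    intro h; have := congrArg Complex.re h; simp at this; exact hγ this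
  have e2 : (γ : ℂ) + w * Complex.I ≠ 0 := by
    intro h; have := congrArg Complex.re h; simp at this; exact hγ this
  have e3 : (w : ℂ) ^ 2 + (γ : ℂ) ^ 2 ≠ 0 := by
    have : (w : ℂ) ^ 2 + (γ : ℂ) ^ 2 = (γ - w * Complex.I) * (γ + w * Complex.I) := by
      ring_nf; rw [Complex.I_sq]; ring
    rw [this]; exact mul_ne_zero e1 e2
  have hpi : (Real.pi : ℂ) ≠ 0 := by exact_mod_cast Real.pi_ne_zero
  rw [h1, h2, integral_exp_mul_complex_Iic (by simpa using hc),
    integral_exp_mul_complex_Ioi (by simpa using hc), cauchyPDFReal_def]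
  push_cast
  simp only [mul_zero, Complex.exp_zero, sub_zero]
  field_simp
  ring_nf
  rw [Complex.I_sq]; ring

/-- The characteristic function of the centred Cauchy distribution of scale `γ`. -/
lemma charFun_cauchyMeasure_zero (γ : ℝ≥0) (t : ℝ) :
    charFun (cauchyMeasure 0 γ) t = (Real.exp (-(γ * |t|)) : ℂ) := by
  rcases eq_or_ne γ 0 with rfl | hγ
  · simp
  have hγ' : (0 : ℝ) < γ := by positivity
  have hc : 0 < 2 * Real.pi * (γ : ℝ) := by positivity
  -- With this normalisation `𝓕 f` is exactly the density, and the claim is Fourier inversion.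
  set f : ℝ → ℂ := fun u : ℝ => (Real.exp (-(2 * Real.pi * γ) * |u|) : ℂ) with hf
  have hF : 𝓕 f = fun w => (cauchyPDFReal 0 γ w : ℂ) := funext (fourier_exp_neg_abs hγ)
  have hinv := Continuous.fourierInv_fourier_eq (f := f) (by fun_prop)
    (integrable_exp_neg_mul_abs hc) (by rw [hF]; exact (integrable_cauchyPDFReal 0).ofReal)
  have := congrFun hinv (t / (2 * Real.pi))
  rw [hF, Real.fourierInv_eq'] at this
  rw [charFun_apply_real, cauchyMeasure_of_scale_ne_zero 0 hγ,
    integral_withDensity_eq_integral_toReal_smul (by fun_prop)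
      (.of_forall fun x => by simp [cauchyPDF])]
  have h3 : f (t / (2 * Real.pi)) = (Real.exp (-(γ * |t|)) : ℂ) := by
    simp only [hf, abs_div, abs_of_pos Real.two_pi_pos]
    congr 2
    field_simp
  rw [← h3, ← this]
  congr 1
  ext x
  rw [cauchyPDF_def, ENNReal.toReal_ofReal (cauchyPDF_pos 0 hγ x).le, Complex.real_smul,
    smul_eq_mul, mul_comm]
  congr 2
  simp only [RCLike.inner_apply, conj_trivial]
  push_cast
  field_simp

section Walk

variable {Ω : Type*} [MeasurableSpace Ω] {P : Measure Ω}
  {X : ℕ → Ω → ℝ}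

/-- The joint characteristic function of finitely many independent standard Cauchy variables. -/
lemma integral_exp_weighted_sum (hindep : iIndepFun X P)
    (hlaw : ∀ i, HasLaw (X i) (cauchyMeasure 0 1) P) (s : Finset ℕ) (c : ℕ → ℝ) :
    ∫ ω, Complex.exp (((∑ i ∈ s, c i * X i ω : ℝ) : ℂ) * Complex.I) ∂P =
      (Real.exp (-∑ i ∈ s, |c i|) : ℂ) := by
  have hm : ∀ i, AEMeasurable (fun ω => c i * X i ω) P := fun i =>
    (hlaw i).aemeasurable.const_mul _
  have hind : iIndepFun (fun i ω => c i * X i ω) P :=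
    hindep.comp (fun i x => c i * x) (fun i => by fun_prop)
  have h := congrFun ((hind.restrict s).charFun_map_fun_finsetSum_eq_prod fun i _ => hm i) 1
  rw [charFun_apply_real, integral_map (Finset.aemeasurable_fun_sum _ fun i _ => hm i)
    (by fun_prop)] at h
  simp only [Complex.ofReal_one, one_mul, Finset.prod_apply] at h
  rw [h]
  have : ∀ i ∈ s, charFun (P.map fun ω => c i * X i ω) 1 = (Real.exp (-|c i|) : ℂ) := by
    intro i _
    rw [charFun_map_mul_comp (hlaw i).aemeasurable, (hlaw i).map_eq, charFun_cauchyMeasure_zero]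
    simp
  rw [Finset.prod_congr rfl this, ← Finset.sum_neg_distrib, Real.exp_sum]
  push_cast
  rfl

lemma aemeasurable_randomWalk (hlaw : ∀ i, HasLaw (X i) (cauchyMeasure 0 1) P) (n : ℕ) :
    AEMeasurable (randomWalk X n) P :=
  Finset.aemeasurable_fun_sum _ fun i _ => (hlaw i).aemeasurable

lemma integral_exp_randomWalk (hindep : iIndepFun X P)
    (hlaw : ∀ i, HasLaw (X i) (cauchyMeasure 0 1) P) (n : ℕ) (t : ℝ) :
    ∫ ω, Complex.exp (((t * randomWalk X n ω : ℝ) : ℂ) * Complex.I) ∂P =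
      (Real.exp (-(n * |t|)) : ℂ) := by
  have := integral_exp_weighted_sum hindep hlaw (Finset.range n) (fun _ => t)
  simpa [randomWalk, Finset.mul_sum] using this

/-- The position of the walk at time `n` is Cauchy of scale `n`. -/
lemma hasLaw_randomWalk [IsProbabilityMeasure P] (hindep : iIndepFun X P)
    (hlaw : ∀ i, HasLaw (X i) (cauchyMeasure 0 1) P) (n : ℕ) :
    HasLaw (randomWalk X n) (cauchyMeasure 0 n) P where
  aemeasurable := aemeasurable_randomWalk hlaw n
  map_eq := by
    have := Measure.isProbabilityMeasure_map (aemeasurable_randomWalk hlaw n)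
    refine Measure.ext_of_charFun (funext fun t => ?_)
    rw [charFun_cauchyMeasure_zero, charFun_apply_real,
      integral_map (aemeasurable_randomWalk hlaw n) (by fun_prop)]
    have := integral_exp_randomWalk hindep hlaw n t
    push_cast at this
    simpa using this

/-- The joint characteristic function of the positions at times `n` and `n + 2`. -/
lemma integral_exp_randomWalk_sub (hindep : iIndepFun X P)
    (hlaw : ∀ i, HasLaw (X i) (cauchyMeasure 0 1) P) (n : ℕ) (u v : ℝ) :
    ∫ ω, Complex.exp (((u * randomWalk X (n + 2) ω - v * randomWalk X n ω : ℝ) : ℂ) * Complex.I) ∂P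
      = (Real.exp (-(2 * |u| + n * |u - v|)) : ℂ) := by
  have := integral_exp_weighted_sum hindep hlaw (Finset.range (n + 2))
    (fun i => if i < n then u - v else u)
  -- The first `n` steps enter both positions, the last two only the later one.
  have e1 : ∀ ω, ∑ i ∈ Finset.range (n + 2), (if i < n then u - v else u) * X i ω =
      u * randomWalk X (n + 2) ω - v * randomWalk X n ω := by
    intro ω
    have h0 : ∑ i ∈ Finset.range n, (if i < n then u - v else u) * X i ω =
        (u - v) * ∑ i ∈ Finset.range n, X i ω := by
      rw [Finset.mul_sum]
      exact Finset.sum_congr rfl fun i hi => by rw [if_pos (Finset.mem_range.mp hi)]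
    simp only [randomWalk]
    rw [Finset.sum_range_succ, Finset.sum_range_succ, h0, Finset.sum_range_succ,
      Finset.sum_range_succ]
    simp
    ring
  have e2 : ∑ i ∈ Finset.range (n + 2), |if i < n then u - v else u| = 2 * |u| + n * |u - v| := by
    have h0 : ∑ i ∈ Finset.range n, |if i < n then u - v else u| = n * |u - v| := by
      rw [Finset.sum_congr rfl fun i hi => by rw [if_pos (Finset.mem_range.mp hi)]]
      simp
    rw [Finset.sum_range_succ, Finset.sum_range_succ, h0]
    simp
    ring
  simp only [e1, e2] at this
  exact this

end Walk

/-! ### The zeta function in the half-plane `0 < Re s` -/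

/-- The Mellin-type integral `∫₁^∞ {x} x^{-s-1} dx`, convergent and holomorphic for `0 < Re s`. -/
noncomputable def fractMellin (s : ℂ) : ℂ :=
  ∫ x in Set.Ioi (1 : ℝ), (x : ℂ) ^ (-(s + 1)) * ((Int.fract x : ℝ) : ℂ)

lemma norm_fract_le_one (x : ℝ) : ‖((Int.fract x : ℝ) : ℂ)‖ ≤ 1 := by
  rw [Complex.norm_real, Real.norm_of_nonneg (Int.fract_nonneg x)]
  exact (Int.fract_lt_one x).le

lemma integrableOn_fractMellin {s : ℂ} (hs : 0 < s.re) :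
    IntegrableOn (fun x : ℝ => (x : ℂ) ^ (-(s + 1)) * ((Int.fract x : ℝ) : ℂ)) (Set.Ioi 1) := by
  have h := integrableOn_Ioi_cpow_of_lt (a := -(s + 1)) (by simp; linarith) one_pos
  exact Integrable.mul_bdd (c := 1) h (by fun_prop) (.of_forall norm_fract_le_one)

lemma differentiableAt_fractMellin {s : ℂ} (hs : 0 < s.re) :
    DifferentiableAt ℂ fractMellin s := by
  set f : ℝ → ℂ := (Set.Ioi (1 : ℝ)).indicator (fun x => ((Int.fract x : ℝ) : ℂ)) with hf
  have hfb : ∀ x, ‖f x‖ ≤ 1 := fun x =>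
    (norm_indicator_le_norm_self _ _).trans (norm_fract_le_one x)
  have hfm : Measurable f := Measurable.indicator (by fun_prop) measurableSet_Ioi
  have heq : fractMellin = fun s => mellin f (-s) := by
    ext s
    have : ∀ x : ℝ, (x : ℂ) ^ (-s - 1) • f x =
        (Set.Ioi (1 : ℝ)).indicator (fun x => (x : ℂ) ^ (-(s + 1)) * ((Int.fract x : ℝ) : ℂ)) x := by
      intro x
      by_cases hx : x ∈ Set.Ioi (1 : ℝ)
      · rw [hf, Set.indicator_of_mem hx, Set.indicator_of_mem hx, smul_eq_mul]
        ring_nf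
      · rw [hf, Set.indicator_of_notMem hx, Set.indicator_of_notMem hx, smul_zero]
    simp only [mellin, this, fractMellin]
    rw [setIntegral_indicator measurableSet_Ioi,
      Set.inter_eq_right.mpr (Set.Ioi_subset_Ioi zero_le_one)]
  have hd : DifferentiableAt ℂ (mellin f) (-s) := by
    refine mellin_differentiableAt_of_isBigO_rpow (a := 0) (b := (-s).re - 1) ?_ ?_ (by simpa) ?_
      (by linarith)
    · refine LocallyIntegrable.locallyIntegrableOn ?_ _
      exact (locallyIntegrable_const (1 : ℝ)).mono hfm.aestronglyMeasurable
        (.of_forall fun x => by simpa using hfb x)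
    · refine IsBigO.of_bound 1 (.of_forall fun x => ?_)
      simpa using hfb x
    · have : f =ᶠ[𝓝[>] 0] fun _ => 0 := by
        filter_upwards [nhdsWithin_le_nhds (Iio_mem_nhds (zero_lt_one' ℝ))] with x hx
        exact Set.indicator_of_notMem (by simpa using le_of_lt hx) _
      exact this.trans_isBigO (isBigO_zero _ _)
  rw [heq]
  exact hd.comp s differentiableAt_id.neg

lemma riemannZeta_eq_of_one_lt_re {s : ℂ} (hs : 1 < s.re) :
    riemannZeta s = s / (s - 1) - s * fractMellin s := by
  have h1 : s - 1 ≠ 0 := by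
    intro h; have := congrArg Complex.re h; simp at this; linarith
  rw [← LSeries_one_eq_riemannZeta hs, LSeries_eq_mul_integral' 1 zero_le_one hs
    (by simpa using isBigO_refl _ _)]
  have hc : ∀ t ∈ Set.Ioi (1 : ℝ), (∑ k ∈ Finset.Icc 1 ⌊t⌋₊, (1 : ℕ → ℂ) k) * (t : ℂ) ^ (-(s + 1)) =
      (t : ℂ) ^ (-s) - (t : ℂ) ^ (-(s + 1)) * ((Int.fract t : ℝ) : ℂ) := by
    intro t ht
    have ht0 : (0 : ℝ) < t := one_pos.trans ht
    have ht0' : (t : ℂ) ≠ 0 := by exact_mod_cast ht0.ne'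
    have e : ((⌊t⌋₊ : ℝ)) = t - Int.fract t := by
      rw [natCast_floor_eq_intCast_floor ht0.le, Int.self_sub_fract]
    have e' : ((⌊t⌋₊ : ℂ)) = t - ((Int.fract t : ℝ) : ℂ) := by exact_mod_cast e
    have e2 : (t : ℂ) ^ (-s) = t * (t : ℂ) ^ (-(s + 1)) := by
      rw [show -s = 1 + -(s + 1) by ring, Complex.cpow_add _ _ ht0', Complex.cpow_one]
    simp only [Pi.one_apply, Finset.sum_const, Nat.card_Icc, add_tsub_cancel_right, nsmul_eq_mul,
      mul_one, e', e2]
    ring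
  rw [setIntegral_congr_fun measurableSet_Ioi hc, integral_sub
    (integrableOn_Ioi_cpow_of_lt (by simpa) one_pos) (integrableOn_fractMellin (by linarith)),
    integral_Ioi_cpow_of_lt (by simpa) one_pos, mul_sub, fractMellin]
  congr 1
  have h2 : -s + 1 ≠ 0 := by
    intro h; exact h1 (by linear_combination -h)
  simp only [Complex.ofReal_one, Complex.one_cpow]
  field_simp
  ring

/-- The formula `ζ(s) = s / (s - 1) - s ∫₁^∞ {x} x^{-s-1} dx`, continued to `0 < Re s`. -/
lemma riemannZeta_eq_of_re_pos {s : ℂ} (hs : 0 < s.re) (hs1 : s ≠ 1) :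
    riemannZeta s = s / (s - 1) - s * fractMellin s := by
  have hopen : IsOpen {s : ℂ | 0 < s.re} := isOpen_lt continuous_const Complex.continuous_re
  have hconv : Convex ℝ {s : ℂ | 0 < s.re} := convex_halfSpace_re_gt 0
  -- The identity theorem is applied to `(s - 1) ζ(s)`, which has no pole in the half-plane.
  have hE : Set.EqOn riemannZeta₁ (fun s => s - s * (s - 1) * fractMellin s) {s : ℂ | 0 < s.re} := by
    refine AnalyticOnNhd.eqOn_of_preconnected_of_eventuallyEq (z₀ := 2)
      (fun z _ => differentiable_riemannZeta₁.analyticAt z) ?_ hconv.isPreconnected (by simp) ?_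
    · refine DifferentiableOn.analyticOnNhd (fun z hz => ?_) hopen
      have := differentiableAt_fractMellin hz
      exact DifferentiableAt.differentiableWithinAt (by fun_prop)
    · have : {s : ℂ | 1 < s.re} ∈ 𝓝 (2 : ℂ) :=
        (isOpen_lt continuous_const Complex.continuous_re).mem_nhds (by simp)
      filter_upwards [this] with z hz
      have hz1 : z ≠ 1 := by rintro rfl; simp at hz
      have h1 : z - 1 ≠ 0 := sub_ne_zero.mpr hz1
      have := riemannZeta_eq_of_one_lt_re hz
      rw [riemannZeta_eq_inv_sub_mul hz1] at this
      field_simp at this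
      linear_combination this
  have h1 : s - 1 ≠ 0 := sub_ne_zero.mpr hs1
  rw [riemannZeta_eq_inv_sub_mul hs1, hE hs]
  field_simp

/-! ### Truncations of the zeta function on the critical line -/

/-- The Dirichlet monomial `x ↦ x^{-1/2-it}`, with modulus and phase separated. -/
noncomputable def powHalf (t x : ℝ) : ℂ :=
  ((x ^ (-1 / 2 : ℝ) : ℝ) : ℂ) * Complex.exp (-((t * Real.log x : ℝ) : ℂ) * Complex.I)

/-- The integral of `x^{-1/2-it}` over `(a, b]` against the signed measure
`∑ k, δ_k - dx`. -/
noncomputable def zetaBlock (a b : ℕ) (t : ℝ) : ℂ :=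
  ∑ k ∈ Finset.Ioc a b, powHalf t k - ∫ x in Set.Ioc (a : ℝ) b, powHalf t x

lemma powHalf_eq_cpow (t : ℝ) {x : ℝ} (hx : 0 < x) :
    powHalf t x = (x : ℂ) ^ (-(1 / 2 + Complex.I * t) : ℂ) := by
  have hx' : (x : ℂ) ≠ 0 := by exact_mod_cast hx.ne'
  rw [powHalf, neg_add, Complex.cpow_add _ _ hx', Complex.ofReal_cpow hx.le]
  congr 1
  · congr 1
    push_cast
    ring
  · rw [Complex.cpow_def_of_ne_zero hx', ← Complex.ofReal_log hx.le]
    congr 1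
    push_cast
    ring

@[fun_prop]
lemma measurable_powHalf : Measurable (fun p : ℝ × ℝ => powHalf p.1 p.2) := by
  unfold powHalf
  fun_prop

lemma norm_powHalf (t x : ℝ) : ‖powHalf t x‖ = ‖x ^ (-1 / 2 : ℝ)‖ := by
  rw [powHalf, norm_mul, ← Complex.ofReal_neg, Complex.norm_exp_ofReal_mul_I, mul_one,
    Complex.norm_real]

lemma integrable_powHalf {m : Measure ℝ} (hm : Integrable (fun x : ℝ => x ^ (-1 / 2 : ℝ)) m)
    (t : ℝ) : Integrable (powHalf t) m :=
  hm.norm.mono' (measurable_powHalf.comp (measurable_prodMk_left (x := t))).aestronglyMeasurable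
    (.of_forall fun x => (norm_powHalf t x).le)

lemma integrableOn_rpow_neg_half (b : ℝ) :
    IntegrableOn (fun x : ℝ => x ^ (-1 / 2 : ℝ)) (Set.Ioc 0 b) := by
  rcases le_total 0 b with hb | hb
  · rw [← intervalIntegrable_iff_integrableOn_Ioc_of_le hb]
    exact intervalIntegral.intervalIntegrable_rpow' (by norm_num)
  · simp [Set.Ioc_eq_empty_of_le hb]

lemma integrableOn_powHalf (t b : ℝ) : IntegrableOn (powHalf t) (Set.Ioc 0 b) :=
  integrable_powHalf (integrableOn_rpow_neg_half b) t

lemma zetaBlock_sub {a b : ℕ} (hab : a ≤ b) (t : ℝ) :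
    zetaBlock 0 b t - zetaBlock 0 a t = zetaBlock a b t := by
  have h1 := Finset.sum_Ioc_consecutive (fun k : ℕ => powHalf t k) (Nat.zero_le a) hab
  have hab' : (a : ℝ) ≤ b := by exact_mod_cast hab
  have h2 : ∫ x in Set.Ioc ((0 : ℕ) : ℝ) b, powHalf t x =
      (∫ x in Set.Ioc ((0 : ℕ) : ℝ) a, powHalf t x) + ∫ x in Set.Ioc (a : ℝ) b, powHalf t x := by
    rw [← setIntegral_union (Set.Ioc_disjoint_Ioc_of_le le_rfl) measurableSet_Ioc,
      Set.Ioc_union_Ioc_eq_Ioc (by simp) hab']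
    · simpa using integrableOn_powHalf t a
    · exact (integrableOn_powHalf t b).mono_set
        (Set.Ioc_subset_Ioc_left (by positivity))
  rw [zetaBlock, zetaBlock, zetaBlock, h2, ← h1]
  ring

/-- Abel summation expresses the truncations through the integral of the fractional part. -/
lemma zetaBlock_zero_eq (N : ℕ) (hN : 1 ≤ N) (t : ℝ) {s : ℂ} (hs : s = 1 / 2 + Complex.I * t) :
    zetaBlock 0 N t =
      s / (s - 1) - s * ∫ x in (1 : ℝ)..N, (x : ℂ) ^ (-(s + 1)) * ((Int.fract x : ℝ) : ℂ) := by
  have hre : s.re = 1 / 2 := by simp [hs]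
  have hN1 : (1 : ℝ) ≤ N := by exact_mod_cast hN
  have hN0 : (0 : ℝ) < N := by linarith
  have hs1 : 1 - s ≠ 0 := by
    intro h; have := congrArg Complex.re h; simp [hre] at this; norm_num at this
  have hs0 : s ≠ 0 := by
    rintro rfl; simp at hre
  have hderiv : ∀ x : ℝ, x ≠ 0 →
      HasDerivAt (fun y : ℝ => (y : ℂ) ^ (-s)) (-s * (x : ℂ) ^ (-s - 1)) x :=
    fun x hx => hasDerivAt_ofReal_cpow_const hx (neg_ne_zero.mpr hs0)
  have hcont : ContinuousOn (fun x : ℝ => -s * (x : ℂ) ^ (-s - 1)) (Set.Icc 1 N) := by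
    intro x hx
    have := Complex.continuousAt_ofReal_cpow_const x (-s - 1)
      (Or.inr (by linarith [hx.1] : x ≠ 0))
    exact (this.const_mul (-s)).continuousWithinAt
  have hdint : IntegrableOn (deriv fun y : ℝ => (y : ℂ) ^ (-s)) (Set.Icc 1 N) := by
    refine hcont.integrableOn_Icc.congr_fun (fun x hx => ?_) measurableSet_Icc
    exact (hderiv x (by linarith [hx.1])).deriv.symm
  have hsum := sum_mul_eq_sub_integral_mul₀' (fun k : ℕ => if k = 0 then (0 : ℂ) else 1)
    (f := fun y : ℝ => (y : ℂ) ^ (-s)) (by simp) N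
    (fun x hx => (hderiv x (by linarith [hx.1])).differentiableAt) hdint
  have hcount : ∀ m : ℕ, ∑ k ∈ Finset.Icc 0 m, (if k = 0 then (0 : ℂ) else 1) = m := by
    intro m
    induction m with
    | zero => simp
    | succ m ih => rw [Finset.sum_Icc_succ_top (by simp), ih]; simp
  have hL : ∑ k ∈ Finset.Ioc 0 N, powHalf t k =
      ∑ k ∈ Finset.Icc 0 N, ((k : ℝ) : ℂ) ^ (-s) * (if k = 0 then (0 : ℂ) else 1) := by
    rw [Finset.Icc_eq_cons_Ioc (Nat.zero_le _), Finset.sum_cons]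
    simp only [if_true, mul_zero, zero_add]
    refine Finset.sum_congr rfl fun k hk => ?_
    have hk0 : 0 < k := (Finset.mem_Ioc.mp hk).1
    rw [powHalf_eq_cpow t (by exact_mod_cast hk0), if_neg hk0.ne', mul_one, hs]
  have hI1 : IntervalIntegrable (fun x : ℝ => (x : ℂ) ^ (-s)) volume 1 N :=
    intervalIntegral.intervalIntegrable_cpow' (by simp [hre]; norm_num)
  have hI2 : IntervalIntegrable
      (fun x : ℝ => (x : ℂ) ^ (-(s + 1)) * ((Int.fract x : ℝ) : ℂ)) volume 1 N := by
    rw [intervalIntegrable_iff_integrableOn_Ioc_of_le hN1]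
    exact (integrableOn_fractMellin (by rw [hre]; norm_num)).mono_set Set.Ioc_subset_Ioi_self
  have hR : ∫ x in Set.Ioc (1 : ℝ) N, deriv (fun y : ℝ => (y : ℂ) ^ (-s)) x *
      ∑ k ∈ Finset.Icc 0 ⌊x⌋₊, (if k = 0 then (0 : ℂ) else 1) =
      -s * ((∫ x in (1 : ℝ)..N, (x : ℂ) ^ (-s)) -
        ∫ x in (1 : ℝ)..N, (x : ℂ) ^ (-(s + 1)) * ((Int.fract x : ℝ) : ℂ)) := by
    rw [← intervalIntegral.integral_sub hI1 hI2, intervalIntegral.integral_of_le hN1,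
      ← integral_const_mul]
    refine setIntegral_congr_fun measurableSet_Ioc fun x hx => ?_
    have hx0 : (0 : ℝ) < x := one_pos.trans hx.1
    have hx0' : (x : ℂ) ≠ 0 := by exact_mod_cast hx0.ne'
    have e : ((⌊x⌋₊ : ℝ)) = x - Int.fract x := by
      rw [natCast_floor_eq_intCast_floor hx0.le, Int.self_sub_fract]
    have e' : ((⌊x⌋₊ : ℂ)) = x - ((Int.fract x : ℝ) : ℂ) := by exact_mod_cast e
    have e2 : (x : ℂ) ^ (-s) = x * (x : ℂ) ^ (-(s + 1)) := by
      rw [show -s = 1 + -(s + 1) by ring, Complex.cpow_add _ _ hx0', Complex.cpow_one]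
    simp only [(hderiv x hx0.ne').deriv, hcount, e', e2]
    rw [show -s - 1 = -(s + 1) by ring]
    ring
  have hC : ∫ x in Set.Ioc ((0 : ℕ) : ℝ) N, powHalf t x = (N : ℂ) ^ (1 - s) / (1 - s) := by
    have : ∀ x ∈ Set.Ioc ((0 : ℕ) : ℝ) N, powHalf t x = (x : ℂ) ^ (-s) := by
      intro x hx
      rw [powHalf_eq_cpow t (by simpa using hx.1), hs]
    rw [setIntegral_congr_fun measurableSet_Ioc this, ← intervalIntegral.integral_of_le (by simp),
      integral_cpow (Or.inl (by simp [hre]; norm_num))]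
    have h1 : -s + 1 ≠ 0 := by intro h; exact hs1 (by linear_combination h)
    simp only [Nat.cast_zero, Complex.ofReal_zero, Complex.zero_cpow h1, sub_zero,
      Complex.ofReal_natCast]
    rw [show -s + 1 = 1 - s by ring]
  have hNs : (N : ℂ) ^ (-s) * N = (N : ℂ) ^ (1 - s) := by
    rw [show 1 - s = -s + 1 by ring, Complex.cpow_add _ _ (by exact_mod_cast hN0.ne'),
      Complex.cpow_one]
  rw [zetaBlock, hL, hsum, hcount, hR, hC, integral_cpow (Or.inl (by simp [hre]; norm_num))]
  simp only [Complex.ofReal_natCast, Complex.ofReal_one, Complex.one_cpow, hNs]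
  rw [show -s + 1 = 1 - s by ring]
  generalize (∫ x in (1 : ℝ)..N, (x : ℂ) ^ (-(s + 1)) * ((Int.fract x : ℝ) : ℂ)) = J
  generalize (N : ℂ) ^ (1 - s) = A
  rw [show s - 1 = -(1 - s) by ring]
  field_simp
  ring

/-- On the critical line the truncations converge to `ζ(1/2 + it)`. -/
lemma tendsto_zetaBlock (t : ℝ) :
    Tendsto (fun N : ℕ => zetaBlock 0 N t) atTop (𝓝 (zetaHalf t)) := by
  set s : ℂ := 1 / 2 + Complex.I * t with hs
  have hre : s.re = 1 / 2 := by simp [hs]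
  have hs1 : s ≠ 1 := by
    intro h; rw [h] at hre; norm_num at hre
  have hpos : 0 < s.re := by rw [hre]; norm_num
  rw [zetaHalf, ← hs, riemannZeta_eq_of_re_pos hpos hs1]
  have h := (intervalIntegral_tendsto_integral_Ioi 1 (integrableOn_fractMellin hpos)
    tendsto_natCast_atTop_atTop).const_mul s |>.const_sub (s / (s - 1))
  refine h.congr' ?_
  filter_upwards [eventually_ge_atTop 1] with N hN
  exact (zetaBlock_zero_eq N hN t hs).symm

lemma continuous_zetaHalf : Continuous zetaHalf := by
  refine continuous_iff_continuousAt.mpr fun t => ?_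
  have hs1 : 1 / 2 + Complex.I * (t : ℂ) ≠ 1 := by
    intro h; have := congrArg Complex.re h; norm_num at this
  exact ContinuousAt.comp (f := fun t : ℝ => 1 / 2 + Complex.I * (t : ℂ))
    (differentiableAt_riemannZeta hs1).continuousAt (by fun_prop)

/-! ### Second moments of Mellin transforms at random points -/

/-- The Mellin transform `∫ x^{-1/2-it} dm(x)` of a measure on the critical line. -/
noncomputable def mellinHalf (m : Measure ℝ) (t : ℝ) : ℂ := ∫ x, powHalf t x ∂m

lemma norm_mellinHalf_le {m : Measure ℝ} (t : ℝ) :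
    ‖mellinHalf m t‖ ≤ ∫ x, ‖x ^ (-1 / 2 : ℝ)‖ ∂m := by
  refine (norm_integral_le_integral_norm _).trans (le_of_eq ?_)
  simp only [norm_powHalf]

@[fun_prop]
lemma measurable_mellinHalf (m : Measure ℝ) [SFinite m] : Measurable (mellinHalf m) := by
  have : StronglyMeasurable (fun p : ℝ × ℝ => powHalf p.1 p.2) :=
    measurable_powHalf.stronglyMeasurable
  exact this.integral_prod_right'.measurable

/-- The sesquilinear form attached to a kernel `κ` which describes second moments of Mellin
transforms evaluated at random points. -/
noncomputable def kernelForm (κ : ℝ → ℝ → ℝ) (m₁ m₂ : Measure ℝ) : ℝ :=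
  ∫ p, p.1 ^ (-1 / 2 : ℝ) * p.2 ^ (-1 / 2 : ℝ) * κ p.1 p.2 ∂(m₁.prod m₂)

section SecondMoment

variable {Ω : Type*} [MeasurableSpace Ω] {P : Measure Ω} [IsProbabilityMeasure P] {U V : Ω → ℝ}

/-- By Fubini, correlations of Mellin transforms at random points are governed by the joint
characteristic function of these points. -/
lemma integral_mellinHalf_mul_conj (hU : AEMeasurable U P) (hV : AEMeasurable V P)
    {κ : ℝ → ℝ → ℝ}
    (hκ : ∀ x y : ℝ, ∫ ω, Complex.exp (((-Real.log x * U ω - -Real.log y * V ω : ℝ) : ℂ) *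
      Complex.I) ∂P = κ x y)
    {m₁ m₂ : Measure ℝ} [SFinite m₁] [SFinite m₂]
    (h₁ : Integrable (fun x : ℝ => x ^ (-1 / 2 : ℝ)) m₁)
    (h₂ : Integrable (fun x : ℝ => x ^ (-1 / 2 : ℝ)) m₂) :
    ∫ ω, mellinHalf m₁ (U ω) * conj (mellinHalf m₂ (V ω)) ∂P = (kernelForm κ m₁ m₂ : ℂ) := by
  have e1 : ∀ ω, mellinHalf m₁ (U ω) * conj (mellinHalf m₂ (V ω)) =
      ∫ p, powHalf (U ω) p.1 * conj (powHalf (V ω) p.2) ∂(m₁.prod m₂) := by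
    intro ω
    rw [mellinHalf, mellinHalf, ← integral_conj]
    exact (integral_prod_mul (powHalf (U ω)) fun y => conj (powHalf (V ω) y)).symm
  simp only [e1]
  rw [integral_integral_swap]
  · rw [kernelForm, ← integral_complex_ofReal]
    refine integral_congr_ae (.of_forall fun p => ?_)
    have e2 : ∀ ω, powHalf (U ω) p.1 * conj (powHalf (V ω) p.2) =
        ((p.1 ^ (-1 / 2 : ℝ) * p.2 ^ (-1 / 2 : ℝ) : ℝ) : ℂ) *
        Complex.exp (((-Real.log p.1 * U ω - -Real.log p.2 * V ω : ℝ) : ℂ) * Complex.I) := by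
      intro ω
      simp only [powHalf, map_mul, Complex.conj_ofReal, ← Complex.exp_conj, map_neg,
        Complex.conj_I]
      rw [mul_mul_mul_comm, ← Complex.exp_add]
      push_cast
      congr 2
      ring
    simp only [e2]
    rw [integral_const_mul, hκ]
    push_cast
    rfl
  · have hb : Integrable (fun q : Ω × ℝ × ℝ => ‖q.2.1 ^ (-1 / 2 : ℝ)‖ * ‖q.2.2 ^ (-1 / 2 : ℝ)‖)
        (P.prod (m₁.prod m₂)) := (h₁.norm.mul_prod h₂.norm).comp_snd P
    refine hb.mono' ?_ (.of_forall fun q => ?_)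
    · have hm1 : AEMeasurable (fun q : Ω × ℝ × ℝ => powHalf (U q.1) q.2.1)
          (P.prod (m₁.prod m₂)) :=
        measurable_powHalf.comp_aemeasurable
          (hU.comp_fst.prodMk (measurable_fst.comp measurable_snd).aemeasurable)
      have hm2 : AEMeasurable (fun q : Ω × ℝ × ℝ => powHalf (V q.1) q.2.2)
          (P.prod (m₁.prod m₂)) :=
        measurable_powHalf.comp_aemeasurable
          (hV.comp_fst.prodMk (measurable_snd.comp measurable_snd).aemeasurable)
      exact (hm1.mul (Complex.continuous_conj.measurable.comp_aemeasurable hm2)).aestronglyMeasurable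
    · simp [Function.uncurry, norm_powHalf]

lemma integrable_mellinHalf_mul_conj (hU : AEMeasurable U P) (hV : AEMeasurable V P)
    (m₁ m₂ : Measure ℝ) [SFinite m₁] [SFinite m₂] :
    Integrable (fun ω => mellinHalf m₁ (U ω) * conj (mellinHalf m₂ (V ω))) P := by
  refine Integrable.of_bound (C := (∫ x, ‖x ^ (-1 / 2 : ℝ)‖ ∂m₁) * ∫ x, ‖x ^ (-1 / 2 : ℝ)‖ ∂m₂)
    ?_ (.of_forall fun ω => ?_)
  · exact (((measurable_mellinHalf m₁).comp_aemeasurable hU).mul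
      (Complex.continuous_conj.measurable.comp_aemeasurable
        ((measurable_mellinHalf m₂).comp_aemeasurable hV))).aestronglyMeasurable
  · rw [norm_mul, RCLike.norm_conj]
    exact mul_le_mul (norm_mellinHalf_le _) (norm_mellinHalf_le _) (norm_nonneg _)
      (integral_nonneg fun _ => norm_nonneg _)

/-- The correlation of the Mellin transforms of the signed measure `m₁ - m₂`. -/
lemma integral_mellinHalf_sub_mul_conj (hU : AEMeasurable U P) (hV : AEMeasurable V P)
    {κ : ℝ → ℝ → ℝ}
    (hκ : ∀ x y : ℝ, ∫ ω, Complex.exp (((-Real.log x * U ω - -Real.log y * V ω : ℝ) : ℂ) *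
      Complex.I) ∂P = κ x y)
    {m₁ m₂ : Measure ℝ} [SFinite m₁] [SFinite m₂]
    (h₁ : Integrable (fun x : ℝ => x ^ (-1 / 2 : ℝ)) m₁)
    (h₂ : Integrable (fun x : ℝ => x ^ (-1 / 2 : ℝ)) m₂) :
    ∫ ω, (mellinHalf m₁ (U ω) - mellinHalf m₂ (U ω)) *
        conj (mellinHalf m₁ (V ω) - mellinHalf m₂ (V ω)) ∂P =
      ((kernelForm κ m₁ m₁ - kernelForm κ m₁ m₂ - kernelForm κ m₂ m₁ + kernelForm κ m₂ m₂ : ℝ) :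
        ℂ) := by
  have i11 := integrable_mellinHalf_mul_conj hU hV m₁ m₁
  have i12 := integrable_mellinHalf_mul_conj hU hV m₁ m₂
  have i21 := integrable_mellinHalf_mul_conj hU hV m₂ m₁
  have i22 := integrable_mellinHalf_mul_conj hU hV m₂ m₂
  have e : ∀ ω, (mellinHalf m₁ (U ω) - mellinHalf m₂ (U ω)) *
        conj (mellinHalf m₁ (V ω) - mellinHalf m₂ (V ω)) =
      mellinHalf m₁ (U ω) * conj (mellinHalf m₁ (V ω)) -
      mellinHalf m₁ (U ω) * conj (mellinHalf m₂ (V ω)) -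
      mellinHalf m₂ (U ω) * conj (mellinHalf m₁ (V ω)) +
      mellinHalf m₂ (U ω) * conj (mellinHalf m₂ (V ω)) := by
    intro ω
    rw [map_sub]
    ring
  simp only [e]
  rw [integral_add (by exact (i11.sub i12).sub i21) i22,
    integral_sub (by exact i11.sub i12) i21, integral_sub i11 i12,
    integral_mellinHalf_mul_conj hU hV hκ h₁ h₁, integral_mellinHalf_mul_conj hU hV hκ h₁ h₂,
    integral_mellinHalf_mul_conj hU hV hκ h₂ h₁, integral_mellinHalf_mul_conj hU hV hκ h₂ h₂]
  push_cast
  rfl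

end SecondMoment

/-- The counting measure of the integers in `(a, b]`. -/
noncomputable def natMeasure (a b : ℕ) : Measure ℝ := ∑ k ∈ Finset.Ioc a b, Measure.dirac (k : ℝ)

instance (a b : ℕ) : IsFiniteMeasure (natMeasure a b) := by
  unfold natMeasure; infer_instance

lemma integrable_natMeasure {E : Type*} [NormedAddCommGroup E] (a b : ℕ) (f : ℝ → E) :
    Integrable f (natMeasure a b) := by
  refine integrable_finsetSum_measure.mpr fun k _ => ?_
  exact integrable_dirac (by simp)

lemma integral_natMeasure {E : Type*} [NormedAddCommGroup E] [NormedSpace ℝ E] [CompleteSpace E]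
    (a b : ℕ) (f : ℝ → E) : ∫ x, f x ∂(natMeasure a b) = ∑ k ∈ Finset.Ioc a b, f k := by
  rw [natMeasure, integral_finsetSum_measure fun k _ => integrable_dirac (by simp)]
  simp

lemma integrable_rpow_restrict (a b : ℕ) :
    Integrable (fun x : ℝ => x ^ (-1 / 2 : ℝ)) (volume.restrict (Set.Ioc (a : ℝ) b)) :=
  (integrableOn_rpow_neg_half b).mono_set (Set.Ioc_subset_Ioc_left (by positivity))

lemma zetaBlock_eq (a b : ℕ) (t : ℝ) :
    zetaBlock a b t = mellinHalf (natMeasure a b) t -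
      mellinHalf (volume.restrict (Set.Ioc (a : ℝ) b)) t := by
  rw [zetaBlock, mellinHalf, integral_natMeasure, mellinHalf]

@[fun_prop]
lemma measurable_zetaBlock (a b : ℕ) : Measurable (zetaBlock a b) := by
  have : zetaBlock a b = fun t => mellinHalf (natMeasure a b) t -
      mellinHalf (volume.restrict (Set.Ioc (a : ℝ) b)) t := funext (zetaBlock_eq a b)
  rw [this]
  fun_prop

lemma exists_norm_zetaBlock_le (a b : ℕ) : ∃ C, ∀ t, ‖zetaBlock a b t‖ ≤ C := by
  refine ⟨(∫ x, ‖x ^ (-1 / 2 : ℝ)‖ ∂(natMeasure a b)) +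
    ∫ x, ‖x ^ (-1 / 2 : ℝ)‖ ∂(volume.restrict (Set.Ioc (a : ℝ) b)), fun t => ?_⟩
  rw [zetaBlock_eq]
  exact (norm_sub_le _ _).trans (add_le_add (norm_mellinHalf_le t) (norm_mellinHalf_le t))

lemma ae_natMeasure (a b : ℕ) : ∀ᵐ x ∂(natMeasure a b), (a : ℝ) < x := by
  have : MeasurableSet {x : ℝ | ¬ (a : ℝ) < x} :=
    (measurableSet_lt measurable_const measurable_id).compl
  rw [ae_iff, natMeasure, Measure.finsetSum_apply]
  refine Finset.sum_eq_zero fun k hk => ?_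
  rw [Measure.dirac_apply' _ this]
  simpa using (Finset.mem_Ioc.mp hk).1

lemma ae_restrict_Ioc (a b : ℕ) : ∀ᵐ x ∂(volume.restrict (Set.Ioc (a : ℝ) b)), (a : ℝ) < x := by
  filter_upwards [ae_restrict_mem measurableSet_Ioc] with x hx using hx.1

/-! ### The mean-square truncation error -/

/-- The kernel `min (x / y) (y / x) ^ c` on positive reals, written as `e^{-c |log x - log y|}`. It is
the characteristic function of a Cauchy variable of scale `c` at `log x - log y`. -/
noncomputable def logKernel (c x y : ℝ) : ℝ := Real.exp (-(c * |Real.log x - Real.log y|))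

@[fun_prop]
lemma measurable_logKernel (c : ℝ) : Measurable (fun p : ℝ × ℝ => logKernel c p.1 p.2) := by
  unfold logKernel
  fun_prop

lemma logKernel_pos (c x y : ℝ) : 0 < logKernel c x y := Real.exp_pos _

lemma logKernel_comm (c x y : ℝ) : logKernel c x y = logKernel c y x := by
  rw [logKernel, logKernel, abs_sub_comm]

lemma logKernel_le_one {c : ℝ} (hc : 0 ≤ c) (x y : ℝ) : logKernel c x y ≤ 1 :=
  Real.exp_le_one_iff.mpr (neg_nonpos.mpr (by positivity))

lemma logKernel_of_le (c : ℝ) {x y : ℝ} (hx : 0 < x) (hxy : x ≤ y) :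
    logKernel c x y = x ^ c * y ^ (-c) := by
  have hy := hx.trans_le hxy
  rw [logKernel, abs_sub_comm, abs_of_nonneg (sub_nonneg.mpr (Real.log_le_log hx hxy)),
    Real.rpow_def_of_pos hx, Real.rpow_def_of_pos hy, ← Real.exp_add]
  congr 1
  ring

lemma integral_Ioi_sq_inv {c : ℝ} (hc : 0 < c) : ∫ z in Set.Ioi c, (z ^ 2)⁻¹ = c⁻¹ := by
  have h := integral_Ioi_rpow_of_lt (a := -2) (by norm_num) hc
  have e : ∀ z ∈ Set.Ioi c, (z ^ 2)⁻¹ = z ^ (-2 : ℝ) := fun z hz => by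
    rw [Real.rpow_neg (hc.trans hz).le]; norm_cast
  rw [setIntegral_congr_fun measurableSet_Ioi e, h, show (-2 : ℝ) + 1 = -1 by norm_num,
    Real.rpow_neg_one]
  ring

lemma integrableOn_Ioi_sq_inv {c : ℝ} (hc : 0 < c) :
    IntegrableOn (fun z : ℝ => (z ^ 2)⁻¹) (Set.Ioi c) := by
  refine (integrableOn_Ioi_rpow_of_lt (a := -2) (by norm_num) hc).congr_fun
    (fun z hz => ?_) measurableSet_Ioi
  beta_reduce
  rw [Real.rpow_neg (hc.trans hz).le]; norm_cast

/-- At scale `1/2` the kernel is `1 / max x y`, which is a superposition of products of indicators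
of half-lines. -/
lemma rpow_mul_logKernel_half {a x y : ℝ} (ha : 0 < a) (hx : a < x) (hy : a < y) :
    x ^ (-1 / 2 : ℝ) * y ^ (-1 / 2 : ℝ) * logKernel (1 / 2) x y =
      ∫ z in Set.Ioi a, (Set.Iic z).indicator 1 x * (Set.Iic z).indicator 1 y * (z ^ 2)⁻¹ := by
  wlog hxy : x ≤ y generalizing x y
  · rw [logKernel_comm, mul_comm (x ^ (-1 / 2 : ℝ)), this hy hx (le_of_not_ge hxy)]
    refine integral_congr_ae (.of_forall fun z => ?_)
    ring_nf
  have hx0 := ha.trans hx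
  have hy0 := ha.trans hy
  have e : ∀ z ∈ Set.Ioi a, (Set.Iic z).indicator 1 x * (Set.Iic z).indicator 1 y * (z ^ 2)⁻¹ =
      (Set.Ici y).indicator (fun z : ℝ => (z ^ 2)⁻¹) z := by
    intro z hz
    by_cases h : y ≤ z
    · rw [Set.indicator_of_mem (show x ∈ Set.Iic z from hxy.trans h),
        Set.indicator_of_mem (show y ∈ Set.Iic z from h),
        Set.indicator_of_mem (show z ∈ Set.Ici y from h)]
      simp
    · rw [Set.indicator_of_notMem (show y ∉ Set.Iic z from h),
        Set.indicator_of_notMem (show z ∉ Set.Ici y from h)]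
      simp
  rw [setIntegral_congr_fun measurableSet_Ioi e, setIntegral_indicator measurableSet_Ici,
    Set.inter_eq_right.mpr (Set.Ici_subset_Ioi.mpr hy), integral_Ici_eq_integral_Ioi,
    integral_Ioi_sq_inv hy0, logKernel_of_le _ hx0 hxy]
  have h1 : x ^ (-1 / 2 : ℝ) * x ^ (1 / 2 : ℝ) = 1 := by
    rw [← Real.rpow_add hx0]; norm_num
  have h2 : y ^ (-1 / 2 : ℝ) * y ^ (-(1 / 2) : ℝ) = y⁻¹ := by
    rw [← Real.rpow_add hy0, ← Real.rpow_neg_one]; norm_num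
  rw [← h2]
  linear_combination (y ^ (-1 / 2 : ℝ) * y ^ (-(1 / 2) : ℝ)) * h1

lemma kernelForm_logKernel_half {a : ℝ} (ha : 0 < a) {m₁ m₂ : Measure ℝ} [IsFiniteMeasure m₁]
    [IsFiniteMeasure m₂] (h₁ : ∀ᵐ x ∂m₁, a < x) (h₂ : ∀ᵐ x ∂m₂, a < x) :
    kernelForm (logKernel (1 / 2)) m₁ m₂ =
      ∫ z in Set.Ioi a, m₁.real (Set.Iic z) * m₂.real (Set.Iic z) * (z ^ 2)⁻¹ := by
  have e : ∀ᵐ p ∂(m₁.prod m₂), p.1 ^ (-1 / 2 : ℝ) * p.2 ^ (-1 / 2 : ℝ) *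
      logKernel (1 / 2) p.1 p.2 = ∫ z in Set.Ioi a, (Set.Iic z).indicator 1 p.1 *
        (Set.Iic z).indicator 1 p.2 * (z ^ 2)⁻¹ := by
    filter_upwards [Measure.quasiMeasurePreserving_fst.ae h₁,
      Measure.quasiMeasurePreserving_snd.ae h₂] with p hp1 hp2
    exact rpow_mul_logKernel_half ha hp1 hp2
  rw [kernelForm, integral_congr_ae e, integral_integral_swap]
  · refine integral_congr_ae (.of_forall fun z => ?_)
    beta_reduce
    rw [integral_mul_const, integral_prod_mul ((Set.Iic z).indicator 1)
      ((Set.Iic z).indicator 1), integral_indicator_one measurableSet_Iic,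
      integral_indicator_one measurableSet_Iic]
  · have hb : Integrable (fun q : (ℝ × ℝ) × ℝ => (q.2 ^ 2)⁻¹)
        ((m₁.prod m₂).prod (volume.restrict (Set.Ioi a))) :=
      Integrable.comp_snd (integrableOn_Ioi_sq_inv ha) _
    refine hb.mono' ?_ (.of_forall fun q => ?_)
    · have hm : ∀ f : (ℝ × ℝ) × ℝ → ℝ, Measurable f → Measurable (fun q : (ℝ × ℝ) × ℝ =>
          (Set.Iic q.2).indicator (1 : ℝ → ℝ) (f q)) := by
        intro f hf
        have : (fun q : (ℝ × ℝ) × ℝ => (Set.Iic q.2).indicator (1 : ℝ → ℝ) (f q)) =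
            {q : (ℝ × ℝ) × ℝ | f q ≤ q.2}.indicator 1 := by
          ext q
          simp [Set.indicator]
        rw [this]
        exact measurable_one.indicator (measurableSet_le hf measurable_snd)
      have := ((hm _ (measurable_fst.comp measurable_fst)).mul
        (hm _ (measurable_snd.comp measurable_fst))).mul
        (f := _) (g := fun q : (ℝ × ℝ) × ℝ => (q.2 ^ 2)⁻¹) (by fun_prop)
      exact this.aestronglyMeasurable
    · have h0 : ∀ x : ℝ, |(Set.Iic q.2).indicator (1 : ℝ → ℝ) x| ≤ 1 := by
        intro x
        by_cases h : x ∈ Set.Iic q.2 <;> simp [h]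
      have hq : 0 ≤ (q.2 ^ 2)⁻¹ := by positivity
      simp only [Function.uncurry, Real.norm_eq_abs, abs_mul, abs_of_nonneg hq]
      exact mul_le_of_le_one_left hq (mul_le_one₀ (h0 _) (abs_nonneg _) (h0 _))

lemma natMeasure_real_Iic (a b : ℕ) {z : ℝ} (hz : (a : ℝ) < z) :
    (natMeasure a b).real (Set.Iic z) = min (b : ℝ) ⌊z⌋₊ - min (b : ℝ) a := by
  have hz0 : 0 ≤ z := a.cast_nonneg.trans hz.le
  have haz : a ≤ ⌊z⌋₊ := Nat.le_floor hz.le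
  rw [← integral_indicator_one measurableSet_Iic, integral_natMeasure]
  have e : ∀ k ∈ Finset.Ioc a b, (Set.Iic z).indicator (1 : ℝ → ℝ) (k : ℝ) =
      if k ≤ ⌊z⌋₊ then 1 else 0 := by
    intro k _
    simp [Set.indicator, Nat.le_floor_iff hz0]
  rw [Finset.sum_congr rfl e, ← Finset.sum_filter, Finset.sum_const, nsmul_eq_mul, mul_one]
  have : (Finset.Ioc a b).filter (· ≤ ⌊z⌋₊) = Finset.Ioc a (min b ⌊z⌋₊) := by
    ext k; simp; tauto
  rw [this, Nat.card_Ioc]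
  rcases le_total a b with hab | hab
  · rw [min_eq_right (by exact_mod_cast hab : (a : ℝ) ≤ b), Nat.cast_sub (le_min hab haz)]
    push_cast
    rfl
  · have h1 : (b : ℝ) ≤ a := by exact_mod_cast hab
    have h2 : (b : ℝ) ≤ (⌊z⌋₊ : ℝ) := by exact_mod_cast hab.trans haz
    rw [min_eq_left h1, min_eq_left h2, Nat.sub_eq_zero_of_le ((min_le_left _ _).trans hab)]
    simp

lemma restrict_real_Iic (a b : ℕ) {z : ℝ} (hz : (a : ℝ) < z) :
    (volume.restrict (Set.Ioc (a : ℝ) b)).real (Set.Iic z) = min (b : ℝ) z - min (b : ℝ) a := by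
  rw [measureReal_restrict_apply measurableSet_Iic]
  have : Set.Iic z ∩ Set.Ioc (a : ℝ) b = Set.Ioc (a : ℝ) (min b z) := by
    ext x; simp; tauto
  rw [this, Real.volume_real_Ioc]
  rcases le_total (a : ℝ) b with hab | hab
  · rw [min_eq_right hab, max_eq_left (sub_nonneg.mpr (le_min hab hz.le))]
  · rw [min_eq_left hab, min_eq_left (hab.trans hz.le), max_eq_right (by linarith), sub_self]

/-- The distribution function of `∑ k, δ_k - dx`, started at an integer, is a negative fractional
part, or vanishes. -/
lemma sq_natMeasure_sub_le (a b : ℕ) {z : ℝ} (hz : (a : ℝ) < z) :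
    ((natMeasure a b).real (Set.Iic z) -
      (volume.restrict (Set.Ioc (a : ℝ) b)).real (Set.Iic z)) ^ 2 ≤ 1 := by
  rw [natMeasure_real_Iic a b hz, restrict_real_Iic a b hz, sub_sub_sub_cancel_right,
    sq_le_one_iff_abs_le_one]
  have hz0 : 0 ≤ z := a.cast_nonneg.trans hz.le
  refine (abs_min_sub_min_le_max _ _ _ _).trans ?_
  have h1 := Nat.floor_le hz0
  have h2 := Nat.lt_floor_add_one z
  rw [sub_self, abs_zero, max_le_iff]
  exact ⟨zero_le_one, abs_le.mpr ⟨by linarith, by linarith⟩⟩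

lemma kernelForm_sub_half_le {a b : ℕ} (ha : 1 ≤ a) :
    kernelForm (logKernel (1 / 2)) (natMeasure a b) (natMeasure a b) -
      kernelForm (logKernel (1 / 2)) (natMeasure a b) (volume.restrict (Set.Ioc (a : ℝ) b)) -
      kernelForm (logKernel (1 / 2)) (volume.restrict (Set.Ioc (a : ℝ) b)) (natMeasure a b) +
      kernelForm (logKernel (1 / 2)) (volume.restrict (Set.Ioc (a : ℝ) b))
        (volume.restrict (Set.Ioc (a : ℝ) b)) ≤ (a : ℝ)⁻¹ := by
  have ha0 : (0 : ℝ) < a := by exact_mod_cast ha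
  set m₁ := natMeasure a b
  set m₂ := volume.restrict (Set.Ioc (a : ℝ) b)
  have h₁ : ∀ᵐ x ∂m₁, (a : ℝ) < x := ae_natMeasure a b
  have h₂ : ∀ᵐ x ∂m₂, (a : ℝ) < x := ae_restrict_Ioc a b
  have hint : ∀ m m' : Measure ℝ, [IsFiniteMeasure m] → [IsFiniteMeasure m'] →
      IntegrableOn (fun z : ℝ => m.real (Set.Iic z) * m'.real (Set.Iic z) * (z ^ 2)⁻¹)
        (Set.Ioi (a : ℝ)) := by
    intro m m' _ _
    have hmono : ∀ m : Measure ℝ, [IsFiniteMeasure m] →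
        Measurable fun z : ℝ => m.real (Set.Iic z) := fun m _ =>
      (show Monotone fun z : ℝ => m.real (Set.Iic z) from
        fun x y hxy => measureReal_mono (Set.Iic_subset_Iic.mpr hxy)).measurable
    refine Integrable.bdd_mul (c := m.real Set.univ * m'.real Set.univ)
      (integrableOn_Ioi_sq_inv ha0) ((hmono m).mul (hmono m')).aestronglyMeasurable
      (.of_forall fun z => ?_)
    rw [Real.norm_of_nonneg (by positivity)]
    exact mul_le_mul (measureReal_mono (Set.subset_univ _)) (measureReal_mono (Set.subset_univ _))
      measureReal_nonneg measureReal_nonneg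
  rw [kernelForm_logKernel_half ha0 h₁ h₁, kernelForm_logKernel_half ha0 h₁ h₂,
    kernelForm_logKernel_half ha0 h₂ h₁, kernelForm_logKernel_half ha0 h₂ h₂,
    ← integral_sub (hint m₁ m₁) (hint m₁ m₂),
    ← integral_sub (by exact (hint m₁ m₁).sub (hint m₁ m₂)) (hint m₂ m₁),
    ← integral_add (by exact ((hint m₁ m₁).sub (hint m₁ m₂)).sub (hint m₂ m₁)) (hint m₂ m₂),
    ← integral_Ioi_sq_inv ha0]
  refine setIntegral_mono_on (((((hint m₁ m₁).sub (hint m₁ m₂)).sub (hint m₂ m₁))).add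
    (hint m₂ m₂)) (integrableOn_Ioi_sq_inv ha0) measurableSet_Ioi fun z hz => ?_
  have h := sq_natMeasure_sub_le a b hz
  have hz2 : 0 ≤ (z ^ 2)⁻¹ := by positivity
  calc _ = (m₁.real (Set.Iic z) - m₂.real (Set.Iic z)) ^ 2 * (z ^ 2)⁻¹ := by ring
    _ ≤ 1 * (z ^ 2)⁻¹ := mul_le_mul_of_nonneg_right h hz2
    _ = _ := one_mul _

/-- The mean square of the blocks at scale `1/2`, uniformly in the right endpoint. -/
lemma integral_norm_zetaBlock_half_le {a b : ℕ} (ha : 1 ≤ a) :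
    ∫ t, ‖zetaBlock a b t‖ ^ 2 ∂(cauchyMeasure 0 (1 / 2)) ≤ (a : ℝ)⁻¹ := by
  have hκ : ∀ x y : ℝ, ∫ t : ℝ, Complex.exp (((-Real.log x * id t - -Real.log y * id t : ℝ) : ℂ) *
      Complex.I) ∂(cauchyMeasure 0 (1 / 2)) = logKernel (1 / 2) x y := by
    intro x y
    have := charFun_cauchyMeasure_zero (1 / 2) (Real.log y - Real.log x)
    rw [charFun_apply_real, abs_sub_comm] at this
    rw [logKernel]
    push_cast at this ⊢
    rw [← this]
    congr 1
    ext t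
    congr 1
    simp only [id]
    ring
  have h := integral_mellinHalf_sub_mul_conj (P := cauchyMeasure 0 (1 / 2)) (U := id) (V := id)
    aemeasurable_id aemeasurable_id hκ (integrable_natMeasure a b _) (integrable_rpow_restrict a b)
  have e : ∀ t : ℝ, (mellinHalf (natMeasure a b) (id t) -
      mellinHalf (volume.restrict (Set.Ioc (a : ℝ) b)) (id t)) *
      conj (mellinHalf (natMeasure a b) (id t) -
      mellinHalf (volume.restrict (Set.Ioc (a : ℝ) b)) (id t)) =
      ((‖zetaBlock a b t‖ ^ 2 : ℝ) : ℂ) := by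
    intro t
    rw [RCLike.mul_conj, zetaBlock_eq]
    simp
  simp only [e] at h
  rw [integral_complex_ofReal] at h
  rw [Complex.ofReal_inj.mp h]
  exact kernelForm_sub_half_le ha

lemma cauchyMeasure_le_smul {n : ℕ} (hn : 1 ≤ n) :
    cauchyMeasure 0 n ≤ ENNReal.ofReal (2 * n) • cauchyMeasure 0 (1 / 2) := by
  have hn0 : (n : ℝ≥0) ≠ 0 := by exact_mod_cast (by omega : n ≠ 0)
  have hn1 : (1 : ℝ) ≤ n := by exact_mod_cast hn
  rw [cauchyMeasure_of_scale_ne_zero 0 hn0, cauchyMeasure_of_scale_ne_zero 0 (by norm_num),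
    ← withDensity_smul _ (by fun_prop)]
  refine withDensity_mono (.of_forall fun t => ?_)
  rw [Pi.smul_apply, smul_eq_mul, cauchyPDF_def, cauchyPDF_def, ← ENNReal.ofReal_mul (by positivity)]
  refine ENNReal.ofReal_le_ofReal ?_
  rw [cauchyPDFReal_def, cauchyPDFReal_def]
  push_cast
  have h : ((t - 0) ^ 2 + (n : ℝ) ^ 2)⁻¹ ≤ ((t - 0) ^ 2 + (1 / 2 : ℝ) ^ 2)⁻¹ := by
    gcongr; linarith
  calc Real.pi⁻¹ * n * ((t - 0) ^ 2 + (n : ℝ) ^ 2)⁻¹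
      ≤ Real.pi⁻¹ * n * ((t - 0) ^ 2 + (1 / 2 : ℝ) ^ 2)⁻¹ := by gcongr
    _ = _ := by ring

lemma lintegral_zetaBlock_le {a b n : ℕ} (ha : 1 ≤ a) (hn : 1 ≤ n) :
    ∫⁻ t, ‖zetaBlock a b t‖ₑ ^ 2 ∂(cauchyMeasure 0 n) ≤ ENNReal.ofReal (2 * n / a) := by
  obtain ⟨C, hC⟩ := exists_norm_zetaBlock_le a b
  have hint : Integrable (fun t => ‖zetaBlock a b t‖ ^ 2) (cauchyMeasure 0 (1 / 2)) := by
    refine Integrable.of_bound (C := C ^ 2) (by fun_prop) (.of_forall fun t => ?_)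
    rw [norm_pow, norm_norm]
    exact pow_le_pow_left₀ (norm_nonneg _) (hC t) 2
  calc ∫⁻ t, ‖zetaBlock a b t‖ₑ ^ 2 ∂(cauchyMeasure 0 n)
      ≤ ∫⁻ t, ‖zetaBlock a b t‖ₑ ^ 2 ∂(ENNReal.ofReal (2 * n) • cauchyMeasure 0 (1 / 2)) :=
        lintegral_mono' (cauchyMeasure_le_smul hn) le_rfl
    _ = ENNReal.ofReal (2 * n) * ENNReal.ofReal (∫ t, ‖zetaBlock a b t‖ ^ 2
          ∂(cauchyMeasure 0 (1 / 2))) := by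
        rw [lintegral_smul_measure, smul_eq_mul, ofReal_integral_eq_lintegral_ofReal hint
          (.of_forall fun t => by positivity)]
        congr 2
        ext t
        rw [ENNReal.ofReal_pow (norm_nonneg _), ofReal_norm]
    _ ≤ ENNReal.ofReal (2 * n) * ENNReal.ofReal ((a : ℝ)⁻¹) := by
        gcongr
        exact integral_norm_zetaBlock_half_le ha
    _ = _ := by rw [← ENNReal.ofReal_mul (by positivity), div_eq_mul_inv]

/-- Mean-square error of the truncation of the zeta function at `a`, with respect to the Cauchy
law of scale `n`. -/
lemma lintegral_zetaHalf_sub_zetaBlock_le {a n : ℕ} (ha : 1 ≤ a) (hn : 1 ≤ n) :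
    ∫⁻ t, ‖zetaHalf t - zetaBlock 0 a t‖ₑ ^ 2 ∂(cauchyMeasure 0 n) ≤
      ENNReal.ofReal (2 * n / a) := by
  -- The blocks `(a, b]` converge pointwise to the error as `b → ∞`; conclude by Fatou's lemma.
  have hlim : ∀ t, ‖zetaHalf t - zetaBlock 0 a t‖ₑ ^ 2 =
      liminf (fun b : ℕ => ‖zetaBlock a b t‖ₑ ^ 2) atTop := by
    intro t
    refine (Tendsto.liminf_eq ?_).symm
    have h1 : Tendsto (fun b : ℕ => zetaBlock a b t) atTop (𝓝 (zetaHalf t - zetaBlock 0 a t)) := by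
      refine ((tendsto_zetaBlock t).sub_const (zetaBlock 0 a t)).congr' ?_
      filter_upwards [eventually_ge_atTop a] with b hb using zetaBlock_sub hb t
    exact (ENNReal.continuous_pow 2).continuousAt.tendsto.comp h1.enorm
  simp only [hlim]
  refine (lintegral_liminf_le fun b => by fun_prop).trans ?_
  refine (liminf_le_liminf (.of_forall fun b => lintegral_zetaBlock_le ha hn)).trans ?_
  simp

/-! ### Mean squares and correlations of the truncations -/

lemma integrable_kernelForm {κ : ℝ → ℝ → ℝ} (hκm : Measurable fun p : ℝ × ℝ => κ p.1 p.2)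
    (hκ : ∀ x y, ‖κ x y‖ ≤ 1) {m₁ m₂ : Measure ℝ} [SFinite m₁] [SFinite m₂]
    (h₁ : Integrable (fun x : ℝ => x ^ (-1 / 2 : ℝ)) m₁)
    (h₂ : Integrable (fun x : ℝ => x ^ (-1 / 2 : ℝ)) m₂) :
    Integrable (fun p : ℝ × ℝ => p.1 ^ (-1 / 2 : ℝ) * p.2 ^ (-1 / 2 : ℝ) * κ p.1 p.2)
      (m₁.prod m₂) :=
  Integrable.mul_bdd (c := 1) (h₁.mul_prod h₂) hκm.aestronglyMeasurable
    (.of_forall fun p => hκ p.1 p.2)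

lemma norm_logKernel_le_one {c : ℝ} (hc : 0 ≤ c) (x y : ℝ) : ‖logKernel c x y‖ ≤ 1 := by
  rw [Real.norm_of_nonneg (logKernel_pos c x y).le]
  exact logKernel_le_one hc x y

lemma kernelForm_logKernel_comm (c : ℝ) (m₁ m₂ : Measure ℝ) [SFinite m₁] [SFinite m₂] :
    kernelForm (logKernel c) m₁ m₂ = kernelForm (logKernel c) m₂ m₁ := by
  rw [kernelForm, kernelForm, ← integral_prod_swap]
  refine integral_congr_ae (.of_forall fun p => ?_)
  simp only [Prod.fst_swap, Prod.snd_swap]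
  rw [logKernel_comm]
  ring

/-- The kernel concentrates at distance of order `y / c` from the diagonal. -/
lemma integral_rpow_mul_logKernel_le {c y b : ℝ} (hc : 1 ≤ c) (hy : 0 < y) :
    ∫ x in Set.Ioc 0 b, x ^ (-1 / 2 : ℝ) * logKernel c y x ≤ 3 / c * y ^ (1 / 2 : ℝ) := by
  set f : ℝ → ℝ := fun x => x ^ (-1 / 2 : ℝ) * logKernel c y x with hf
  have e1 : ∀ x ∈ Set.Ioc 0 y, x ^ (c - 1 / 2) * y ^ (-c) = f x := by
    intro x hx
    simp only [hf]
    rw [logKernel_comm, logKernel_of_le c hx.1 hx.2, ← mul_assoc, ← Real.rpow_add hx.1]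
    ring_nf
  have e2 : ∀ x ∈ Set.Ioi y, y ^ c * x ^ (-c - 1 / 2) = f x := by
    intro x hx
    have hx0 : 0 < x := hy.trans hx
    simp only [hf]
    rw [logKernel_of_le c hy (le_of_lt hx), show -c - 1 / 2 = -1 / 2 + -c by ring,
      Real.rpow_add hx0]
    ring
  have i1 : IntegrableOn f (Set.Ioc 0 y) := by
    refine IntegrableOn.congr_fun ?_ e1 measurableSet_Ioc
    refine Integrable.mul_const ?_ _
    exact (intervalIntegrable_iff_integrableOn_Ioc_of_le hy.le).mp
      (intervalIntegral.intervalIntegrable_rpow' (by linarith))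
  have i2 : IntegrableOn f (Set.Ioi y) := by
    refine IntegrableOn.congr_fun ?_ e2 measurableSet_Ioi
    exact (integrableOn_Ioi_rpow_of_lt (by linarith) hy).const_mul _
  have hU : Set.Ioc 0 y ∪ Set.Ioi y = Set.Ioi 0 := Set.Ioc_union_Ioi_eq_Ioi hy.le
  have i3 : IntegrableOn f (Set.Ioi 0) := hU ▸ i1.union i2
  have hyy : y ^ (c + 1 / 2) * y ^ (-c) = y ^ (1 / 2 : ℝ) := by
    rw [← Real.rpow_add hy]; ring_nf
  have hyy2 : y ^ c * y ^ (-c + 1 / 2) = y ^ (1 / 2 : ℝ) := by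
    rw [← Real.rpow_add hy]; ring_nf
  have hpos : 0 < y ^ (1 / 2 : ℝ) := by positivity
  calc ∫ x in Set.Ioc 0 b, f x ≤ ∫ x in Set.Ioi 0, f x := by
        refine setIntegral_mono_set i3 ?_ (Set.Ioc_subset_Ioi_self).eventuallyLE
        filter_upwards [ae_restrict_mem measurableSet_Ioi] with x hx
        exact mul_nonneg (Real.rpow_nonneg (le_of_lt hx) _) (logKernel_pos c y x).le
    _ = (∫ x in Set.Ioc 0 y, x ^ (c - 1 / 2) * y ^ (-c)) +
          ∫ x in Set.Ioi y, y ^ c * x ^ (-c - 1 / 2) := by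
        rw [← hU, setIntegral_union (by
          rw [Set.disjoint_left]; intro x hx hx'; exact absurd hx.2 (not_le.mpr hx'))
          measurableSet_Ioi i1 i2, setIntegral_congr_fun measurableSet_Ioc e1,
          setIntegral_congr_fun measurableSet_Ioi e2]
    _ = y ^ (1 / 2 : ℝ) / (c + 1 / 2) + y ^ (1 / 2 : ℝ) / (c - 1 / 2) := by
        rw [integral_mul_const, integral_const_mul, integral_Ioi_rpow_of_lt (by linarith) hy,
          ← intervalIntegral.integral_of_le hy.le, integral_rpow (Or.inl (by linarith)),
          show c - 1 / 2 + 1 = c + 1 / 2 by ring, show -c - 1 / 2 + 1 = -c + 1 / 2 by ring,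
          Real.zero_rpow (by linarith), sub_zero, div_mul_eq_mul_div, hyy]
        congr 1
        rw [mul_div_assoc', mul_neg, hyy2, show -c + 1 / 2 = -(c - 1 / 2) by ring, neg_div_neg_eq]
    _ ≤ y ^ (1 / 2 : ℝ) / c + y ^ (1 / 2 : ℝ) / (c / 2) := by
        gcongr <;> linarith
    _ = _ := by field_simp; norm_num

/-- Interactions with the continuous part of the truncation are `O(N / c)`. -/
lemma kernelForm_restrict_le {c : ℝ} (hc : 1 ≤ c) {m : Measure ℝ} [IsFiniteMeasure m]
    (hm : ∀ᵐ x ∂m, 0 < x) (hmi : Integrable (fun x : ℝ => x ^ (-1 / 2 : ℝ)) m) (N : ℕ) :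
    |kernelForm (logKernel c) m (volume.restrict (Set.Ioc ((0 : ℕ) : ℝ) N))| ≤
      3 / c * m.real Set.univ := by
  have hI := integrable_kernelForm (measurable_logKernel c)
    (norm_logKernel_le_one (by linarith)) hmi (integrable_rpow_restrict 0 N)
  rw [abs_of_nonneg]
  · rw [kernelForm, integral_prod _ hI]
    have : ∀ᵐ y ∂m, ∫ x, y ^ (-1 / 2 : ℝ) * x ^ (-1 / 2 : ℝ) * logKernel c y x
        ∂(volume.restrict (Set.Ioc ((0 : ℕ) : ℝ) N)) ≤ 3 / c := by
      filter_upwards [hm] with y hy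
      simp only [mul_assoc, Nat.cast_zero]
      rw [integral_const_mul]
      calc _ ≤ y ^ (-1 / 2 : ℝ) * (3 / c * y ^ (1 / 2 : ℝ)) := by
            gcongr; exact integral_rpow_mul_logKernel_le hc hy
        _ = 3 / c * (y ^ (-1 / 2 : ℝ) * y ^ (1 / 2 : ℝ)) := by ring
        _ = 3 / c := by rw [← Real.rpow_add hy]; norm_num
    refine (integral_mono_ae hI.integral_prod_left (integrable_const _) this).trans (le_of_eq ?_)
    rw [integral_const, smul_eq_mul, mul_comm]
  · refine integral_nonneg_of_ae ?_
    filter_upwards [Measure.quasiMeasurePreserving_fst.ae hm,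
      Measure.quasiMeasurePreserving_snd.ae (ae_restrict_Ioc 0 N)] with p h1 h2
    have h2' : 0 < p.2 := by simpa using h2
    have := (logKernel_pos c p.1 p.2).le
    simp only [Pi.zero_apply]
    positivity

lemma kernelForm_natMeasure {c : ℝ} (hc : 0 ≤ c) (N : ℕ) :
    kernelForm (logKernel c) (natMeasure 0 N) (natMeasure 0 N) =
      ∑ k ∈ Finset.Ioc 0 N, ∑ l ∈ Finset.Ioc 0 N,
        (k : ℝ) ^ (-1 / 2 : ℝ) * (l : ℝ) ^ (-1 / 2 : ℝ) * logKernel c k l := by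
  rw [kernelForm, integral_prod _ (integrable_kernelForm (measurable_logKernel c)
    (norm_logKernel_le_one hc) (integrable_natMeasure 0 N _) (integrable_natMeasure 0 N _)),
    integral_natMeasure]
  simp only [integral_natMeasure]

/-- Off-diagonal decay of the kernel, in the range where `N / c` is bounded. -/
lemma rpow_mul_logKernel_le {c : ℝ} (hc : 1 ≤ c) {N k l : ℕ} (hk : 0 < k) (hl : 0 < l)
    (hkN : k ≤ N) (hlN : l ≤ N) (hkl : k ≠ l) :
    (k : ℝ) ^ (-1 / 2 : ℝ) * (l : ℝ) ^ (-1 / 2 : ℝ) * logKernel c k l ≤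
      8 * N / c ^ 2 * (1 / ((k : ℝ) - l) ^ 2) := by
  wlog h : k < l generalizing k l
  · have := this hl hk hlN hkN hkl.symm (lt_of_le_of_ne (not_lt.mp h) hkl.symm)
    rw [logKernel_comm, mul_comm ((k : ℝ) ^ (-1 / 2 : ℝ)), ← neg_sub (l : ℝ), neg_sq]
    exact this
  have hk' : (0 : ℝ) < k := by exact_mod_cast hk
  have hl' : (0 : ℝ) < l := by exact_mod_cast hl
  have hlN' : (l : ℝ) ≤ N := by exact_mod_cast hlN
  have hd : (0 : ℝ) < l - k := sub_pos.mpr (by exact_mod_cast h)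
  set u := Real.log l - Real.log k with hu
  have hu1 : (l - k) / l ≤ u := by
    have := Real.log_le_sub_one_of_pos (div_pos hk' hl')
    rw [Real.log_div hk'.ne' hl'.ne'] at this
    have e : ((l : ℝ) - k) / l = 1 - k / l := by field_simp
    rw [e, hu]; linarith
  have hu0 : 0 < (l - k) / (l : ℝ) := by positivity
  -- Half a power of the kernel is spent on balancing `(k l)^{-1/2}` to `1 / l`.
  have e : (k : ℝ) ^ (-1 / 2 : ℝ) * (l : ℝ) ^ (-1 / 2 : ℝ) * logKernel c k l =
      (l : ℝ)⁻¹ * Real.exp (-((c - 1 / 2) * u)) := by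
    rw [logKernel, abs_sub_comm, abs_of_pos (by linarith), Real.rpow_def_of_pos hk',
      Real.rpow_def_of_pos hl', ← Real.exp_log (inv_pos.mpr hl'), Real.log_inv, ← Real.exp_add,
      ← Real.exp_add, ← Real.exp_add]
    congr 1
    ring
  set v := c / 2 * ((l - k) / (l : ℝ)) with hv
  have hv0 : 0 < v := by positivity
  have h1 : Real.exp (-((c - 1 / 2) * u)) ≤ 2 / v ^ 2 := by
    have hvu : v ≤ (c - 1 / 2) * u := by
      exact mul_le_mul (by linarith) hu1 hu0.le (by linarith)
    calc Real.exp (-((c - 1 / 2) * u)) ≤ Real.exp (-v) := Real.exp_le_exp.mpr (by linarith)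
      _ = (Real.exp v)⁻¹ := Real.exp_neg v
      _ ≤ (v ^ 2 / 2)⁻¹ := by
          gcongr
          have := Real.quadratic_le_exp_of_nonneg hv0.le
          linarith
      _ = _ := by rw [inv_div]
  rw [e]
  calc (l : ℝ)⁻¹ * Real.exp (-((c - 1 / 2) * u)) ≤ (l : ℝ)⁻¹ * (2 / v ^ 2) := by gcongr
    _ = 8 * l / c ^ 2 * (1 / ((k : ℝ) - l) ^ 2) := by
        rw [hv, ← neg_sub (l : ℝ), neg_sq]
        field_simp
        norm_num
    _ ≤ _ := by gcongr

/-- Extending the sum to all integers is harmless: the term `d = 0` is `1 / 0 = 0`. -/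
lemma sum_one_div_sub_sq_le (N k : ℕ) :
    ∑ l ∈ (Finset.Ioc 0 N).erase k, 1 / ((k : ℝ) - l) ^ 2 ≤ ∑' d : ℤ, 1 / (d : ℝ) ^ 2 := by
  have hinj : Set.InjOn (fun l : ℕ => (k : ℤ) - l) ((Finset.Ioc 0 N).erase k : Finset ℕ) := by
    intro a _ b _ hab
    simpa using hab
  have : ∑ l ∈ (Finset.Ioc 0 N).erase k, 1 / ((k : ℝ) - l) ^ 2 =
      ∑ d ∈ ((Finset.Ioc 0 N).erase k).image (fun l : ℕ => (k : ℤ) - l), 1 / (d : ℝ) ^ 2 := by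
    rw [Finset.sum_image hinj]
    push_cast
    rfl
  rw [this]
  exact (Real.summable_one_div_int_pow.mpr one_lt_two).sum_le_tsum _ fun d _ => by positivity

/-- The Dirichlet polynomial part contributes its diagonal up to `O((N / c)²)`. -/
lemma abs_kernelForm_natMeasure_sub_le {c : ℝ} (hc : 1 ≤ c) (N : ℕ) :
    |kernelForm (logKernel c) (natMeasure 0 N) (natMeasure 0 N) -
      ∑ k ∈ Finset.Ioc 0 N, (k : ℝ)⁻¹| ≤ 8 * (∑' d : ℤ, 1 / (d : ℝ) ^ 2) * (N / c) ^ 2 := by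
  set T := ∑' d : ℤ, 1 / (d : ℝ) ^ 2
  have hrow : ∀ k ∈ Finset.Ioc 0 N, |∑ l ∈ Finset.Ioc 0 N,
      (k : ℝ) ^ (-1 / 2 : ℝ) * (l : ℝ) ^ (-1 / 2 : ℝ) * logKernel c k l - (k : ℝ)⁻¹| ≤
      8 * N / c ^ 2 * T := by
    intro k hk
    have hk0 := (Finset.mem_Ioc.mp hk).1
    have hk' : (0 : ℝ) < k := by exact_mod_cast hk0
    rw [← Finset.add_sum_erase _ _ hk]
    have hdiag : (k : ℝ) ^ (-1 / 2 : ℝ) * (k : ℝ) ^ (-1 / 2 : ℝ) * logKernel c k k =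
        (k : ℝ)⁻¹ := by
      rw [logKernel, sub_self, abs_zero, mul_zero, neg_zero, Real.exp_zero, mul_one,
        ← Real.rpow_add hk', ← Real.rpow_neg_one]
      norm_num
    rw [hdiag, add_sub_cancel_left, abs_of_nonneg (Finset.sum_nonneg fun l _ =>
      mul_nonneg (by positivity) (logKernel_pos _ _ _).le)]
    calc _ ≤ ∑ l ∈ (Finset.Ioc 0 N).erase k, 8 * N / c ^ 2 * (1 / ((k : ℝ) - l) ^ 2) := by
          refine Finset.sum_le_sum fun l hl => ?_
          obtain ⟨hlk, hl⟩ := Finset.mem_erase.mp hl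
          obtain ⟨hl0, hlN⟩ := Finset.mem_Ioc.mp hl
          exact rpow_mul_logKernel_le hc hk0 hl0 (Finset.mem_Ioc.mp hk).2 hlN hlk.symm
      _ ≤ _ := by
          rw [← Finset.mul_sum]
          gcongr
          exact sum_one_div_sub_sq_le N k
  rw [kernelForm_natMeasure (by linarith), ← Finset.sum_sub_distrib]
  refine (Finset.abs_sum_le_sum_abs _ _).trans ((Finset.sum_le_sum hrow).trans (le_of_eq ?_))
  rw [Finset.sum_const, Nat.card_Ioc, nsmul_eq_mul, Nat.sub_zero, div_pow]
  ring

lemma natMeasure_real_univ (N : ℕ) : (natMeasure 0 N).real Set.univ = N := by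
  have : ∫ _, (1 : ℝ) ∂(natMeasure 0 N) = N := by
    rw [integral_natMeasure]; simp
  simpa using this

lemma ae_pos_natMeasure (N : ℕ) : ∀ᵐ x ∂(natMeasure 0 N), 0 < x := by
  simpa using ae_natMeasure 0 N

lemma ae_pos_restrict (N : ℕ) :
    ∀ᵐ x ∂(volume.restrict (Set.Ioc ((0 : ℕ) : ℝ) N)), 0 < x := by
  simpa using ae_restrict_Ioc 0 N

/-- The function `x^{-1/2} min(1, 1/x)`, whose tensor square dominates the kernel of the
correlation between the times `n` and `n + 2`. -/
noncomputable def crossWeight (x : ℝ) : ℝ := x ^ (-1 / 2 : ℝ) * Real.exp (-max (Real.log x) 0)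

lemma crossWeight_of_one_le {x : ℝ} (hx : 1 ≤ x) : crossWeight x = x ^ (-3 / 2 : ℝ) := by
  have hx0 : 0 < x := by linarith
  rw [crossWeight, max_eq_left (Real.log_nonneg hx), Real.exp_neg, Real.exp_log hx0,
    ← Real.rpow_neg_one, ← Real.rpow_add hx0]
  norm_num

lemma crossWeight_of_le_one {x : ℝ} (hx0 : 0 ≤ x) (hx : x ≤ 1) :
    crossWeight x = x ^ (-1 / 2 : ℝ) := by
  rw [crossWeight, max_eq_right (Real.log_nonpos hx0 hx)]
  simp

lemma crossWeight_nonneg {x : ℝ} (hx : 0 ≤ x) : 0 ≤ crossWeight x := by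
  unfold crossWeight
  positivity

lemma integrableOn_crossWeight : IntegrableOn crossWeight (Set.Ioi 0) := by
  rw [← Set.Ioc_union_Ioi_eq_Ioi (zero_le_one' ℝ)]
  refine IntegrableOn.union ?_ ?_
  · exact (integrableOn_rpow_neg_half 1).congr_fun
      (fun x hx => (crossWeight_of_le_one hx.1.le hx.2).symm) measurableSet_Ioc
  · exact (integrableOn_Ioi_rpow_of_lt (a := -3 / 2) (by norm_num) one_pos).congr_fun
      (fun x hx => (crossWeight_of_one_le (le_of_lt hx)).symm) measurableSet_Ioi

lemma exists_integral_crossWeight_le :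
    ∃ B, ∀ N : ℕ, ∫ x, crossWeight x ∂(natMeasure 0 N) ≤ B ∧
      ∫ x, crossWeight x ∂(volume.restrict (Set.Ioc ((0 : ℕ) : ℝ) N)) ≤ B := by
  refine ⟨max (∑' k : ℕ, 1 / (k : ℝ) ^ (3 / 2 : ℝ)) (∫ x in Set.Ioi 0, crossWeight x),
    fun N => ⟨le_max_of_le_left ?_, le_max_of_le_right ?_⟩⟩
  · rw [integral_natMeasure]
    have : ∀ k ∈ Finset.Ioc 0 N, crossWeight k = 1 / (k : ℝ) ^ (3 / 2 : ℝ) := by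
      intro k hk
      have : 1 ≤ k := (Finset.mem_Ioc.mp hk).1
      rw [crossWeight_of_one_le (by exact_mod_cast this), one_div, ← Real.rpow_neg (by positivity)]
      norm_num
    rw [Finset.sum_congr rfl this]
    exact (Real.summable_one_div_nat_rpow.mpr (by norm_num)).sum_le_tsum _ fun k _ => by positivity
  · refine setIntegral_mono_set integrableOn_crossWeight ?_ ?_
    · filter_upwards [ae_restrict_mem measurableSet_Ioi] with x hx
      exact crossWeight_nonneg (le_of_lt hx)
    · rw [Nat.cast_zero]
      exact (Set.Ioc_subset_Ioi_self).eventuallyLE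

/-- The kernel governing the correlation between the times `n` and `n + 2`. -/
noncomputable def crossKernel (c x y : ℝ) : ℝ :=
  Real.exp (-(2 * |Real.log x| + c * |Real.log x - Real.log y|))

lemma rpow_mul_crossKernel_le {c : ℝ} (hc : 1 ≤ c) {x y : ℝ} (hx : 0 < x) (hy : 0 < y) :
    x ^ (-1 / 2 : ℝ) * y ^ (-1 / 2 : ℝ) * crossKernel c x y ≤ crossWeight x * crossWeight y := by
  rw [crossWeight, crossWeight, mul_mul_mul_comm, ← Real.exp_add, crossKernel]
  gcongr
  set u := Real.log x
  set v := Real.log y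
  have h1 : |u - v| ≤ c * |u - v| := le_mul_of_one_le_left (abs_nonneg _) hc
  have h2 : max v 0 ≤ max u 0 + |u - v| := by
    refine max_le ?_ (by positivity)
    have := neg_abs_le (u - v)
    linarith [le_max_left u 0]
  have h3 : max u 0 ≤ |u| := max_le (le_abs_self u) (abs_nonneg u)
  linarith

lemma abs_kernelForm_crossKernel_le {c : ℝ} (hc : 1 ≤ c) {m₁ m₂ : Measure ℝ} [SFinite m₁]
    [SFinite m₂] (h₁ : ∀ᵐ x ∂m₁, 0 < x) (h₂ : ∀ᵐ x ∂m₂, 0 < x)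
    (i₁ : Integrable crossWeight m₁) (i₂ : Integrable crossWeight m₂) :
    |kernelForm (crossKernel c) m₁ m₂| ≤ (∫ x, crossWeight x ∂m₁) * ∫ x, crossWeight x ∂m₂ := by
  rw [← integral_prod_mul, kernelForm, ← Real.norm_eq_abs]
  refine norm_integral_le_of_norm_le (i₁.mul_prod i₂) ?_
  filter_upwards [Measure.quasiMeasurePreserving_fst.ae h₁,
    Measure.quasiMeasurePreserving_snd.ae h₂] with p hp1 hp2
  have : 0 ≤ crossKernel c p.1 p.2 := (Real.exp_pos _).le
  rw [Real.norm_of_nonneg (by positivity)]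
  exact rpow_mul_crossKernel_le hc hp1 hp2

section Walk

variable {Ω : Type*} [MeasurableSpace Ω] {P : Measure Ω} [IsProbabilityMeasure P]
  {X : ℕ → Ω → ℝ}

/-- The mean square of the truncation at `N` along the walk is the harmonic sum up to `N`, with an
error controlled by `N / n`. -/
lemma exists_abs_integral_norm_zetaBlock_sub_le (hindep : iIndepFun X P)
    (hlaw : ∀ i, HasLaw (X i) (cauchyMeasure 0 1) P) :
    ∃ C : ℝ, ∀ n N : ℕ, 1 ≤ n →
      |∫ ω, ‖zetaBlock 0 N (randomWalk X n ω)‖ ^ 2 ∂P - ∑ k ∈ Finset.Ioc 0 N, (k : ℝ)⁻¹| ≤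
        C * (N / n) ^ 2 + 9 * (N / n) := by
  refine ⟨8 * ∑' d : ℤ, 1 / (d : ℝ) ^ 2, fun n N hn => ?_⟩
  have hn1 : (1 : ℝ) ≤ n := by exact_mod_cast hn
  have hU := aemeasurable_randomWalk hlaw n
  have hκ : ∀ x y : ℝ, ∫ ω, Complex.exp (((-Real.log x * randomWalk X n ω -
      -Real.log y * randomWalk X n ω : ℝ) : ℂ) * Complex.I) ∂P = logKernel n x y := by
    intro x y
    have := integral_exp_randomWalk hindep hlaw n (Real.log y - Real.log x)
    rw [abs_sub_comm] at this
    rw [logKernel, ← this]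
    congr 1
    ext ω
    congr 3
    ring
  have h := integral_mellinHalf_sub_mul_conj hU hU hκ (integrable_natMeasure 0 N _)
    (integrable_rpow_restrict 0 N)
  have e : ∀ t : ℝ, (mellinHalf (natMeasure 0 N) t -
      mellinHalf (volume.restrict (Set.Ioc ((0 : ℕ) : ℝ) N)) t) *
      conj (mellinHalf (natMeasure 0 N) t -
      mellinHalf (volume.restrict (Set.Ioc ((0 : ℕ) : ℝ) N)) t) =
      ((‖zetaBlock 0 N t‖ ^ 2 : ℝ) : ℂ) := by
    intro t
    rw [RCLike.mul_conj, zetaBlock_eq]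
    simp
  simp only [e] at h
  rw [integral_complex_ofReal] at h
  rw [Complex.ofReal_inj.mp h]
  have b1 := abs_le.mp (abs_kernelForm_natMeasure_sub_le hn1 N)
  have b2 := abs_le.mp (kernelForm_restrict_le hn1 (ae_pos_natMeasure N)
    (integrable_natMeasure 0 N _) N)
  have b3 := abs_le.mp (kernelForm_restrict_le hn1 (ae_pos_restrict N)
    (integrable_rpow_restrict 0 N) N)
  have hvol : (volume.restrict (Set.Ioc ((0 : ℕ) : ℝ) N)).real Set.univ = N := by
    simp
  rw [natMeasure_real_univ] at b2
  rw [hvol] at b3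
  rw [kernelForm_logKernel_comm n (volume.restrict (Set.Ioc ((0 : ℕ) : ℝ) N)) (natMeasure 0 N)]
  have hd : 3 / (n : ℝ) * N = 3 * (N / n) := by ring
  rw [hd] at b2 b3
  refine abs_le.mpr ⟨by linarith [b1.1, b2.2, b3.1], by linarith [b1.2, b2.1, b3.2]⟩

/-- The correlation of the truncations at the times `n` and `n + 2` is bounded, uniformly in the
truncation. -/
lemma exists_norm_integral_zetaBlock_mul_conj_le (hindep : iIndepFun X P)
    (hlaw : ∀ i, HasLaw (X i) (cauchyMeasure 0 1) P) :
    ∃ C : ℝ, ∀ n N : ℕ, 1 ≤ n →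
      ‖∫ ω, zetaBlock 0 N (randomWalk X (n + 2) ω) *
        conj (zetaBlock 0 N (randomWalk X n ω)) ∂P‖ ≤ C := by
  obtain ⟨B, hB⟩ := exists_integral_crossWeight_le
  refine ⟨4 * B ^ 2, fun n N hn => ?_⟩
  have hn1 : (1 : ℝ) ≤ n := by exact_mod_cast hn
  have hκ : ∀ x y : ℝ, ∫ ω, Complex.exp (((-Real.log x * randomWalk X (n + 2) ω -
      -Real.log y * randomWalk X n ω : ℝ) : ℂ) * Complex.I) ∂P = crossKernel n x y := by
    intro x y
    rw [integral_exp_randomWalk_sub hindep hlaw, crossKernel, abs_neg, neg_sub_neg, abs_sub_comm]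
  have h := integral_mellinHalf_sub_mul_conj (aemeasurable_randomWalk hlaw (n + 2))
    (aemeasurable_randomWalk hlaw n) hκ (integrable_natMeasure 0 N _) (integrable_rpow_restrict 0 N)
  simp only [← zetaBlock_eq] at h
  rw [h, Complex.norm_real, Real.norm_eq_abs]
  have p₁ := ae_pos_natMeasure N
  have p₂ := ae_pos_restrict N
  have i₁ := integrable_natMeasure 0 N crossWeight
  have i₂ : Integrable crossWeight (volume.restrict (Set.Ioc ((0 : ℕ) : ℝ) N)) := by
    rw [Nat.cast_zero]
    exact integrableOn_crossWeight.mono_set Set.Ioc_subset_Ioi_self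
  obtain ⟨B₁, B₂⟩ := hB N
  have n₁ : 0 ≤ ∫ x, crossWeight x ∂(natMeasure 0 N) :=
    integral_nonneg_of_ae (p₁.mono fun x hx => crossWeight_nonneg hx.le)
  have n₂ : 0 ≤ ∫ x, crossWeight x ∂(volume.restrict (Set.Ioc ((0 : ℕ) : ℝ) N)) :=
    integral_nonneg_of_ae (p₂.mono fun x hx => crossWeight_nonneg hx.le)
  have B0 := n₁.trans B₁
  have c11 := abs_le.mp ((abs_kernelForm_crossKernel_le hn1 p₁ p₁ i₁ i₁).trans
    (mul_le_mul B₁ B₁ n₁ B0))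
  have c12 := abs_le.mp ((abs_kernelForm_crossKernel_le hn1 p₁ p₂ i₁ i₂).trans
    (mul_le_mul B₁ B₂ n₂ B0))
  have c21 := abs_le.mp ((abs_kernelForm_crossKernel_le hn1 p₂ p₁ i₂ i₁).trans
    (mul_le_mul B₂ B₁ n₁ B0))
  have c22 := abs_le.mp ((abs_kernelForm_crossKernel_le hn1 p₂ p₂ i₂ i₂).trans
    (mul_le_mul B₂ B₂ n₂ B0))
  refine abs_le.mpr ⟨?_, ?_⟩ <;>
    linarith [c11.1, c11.2, c12.1, c12.2, c21.1, c21.2, c22.1, c22.2]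

end Walk

/-! ### Passage to the limit in `L²` -/

section HilbertSpace

variable {Ω : Type*} [MeasurableSpace Ω] {P : Measure Ω}

lemma inner_toLp_eq_integral {f g : Ω → ℂ} (hf : MemLp f 2 P) (hg : MemLp g 2 P) :
    inner ℂ (hf.toLp f) (hg.toLp g) = ∫ ω, g ω * conj (f ω) ∂P := by
  rw [L2.inner_def]
  refine integral_congr_ae ?_
  filter_upwards [hf.coeFn_toLp, hg.coeFn_toLp] with ω h1 h2
  rw [h1, h2, RCLike.inner_apply]

lemma norm_toLp_sq_eq_integral {f : Ω → ℂ} (hf : MemLp f 2 P) :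
    ‖hf.toLp f‖ ^ 2 = ∫ ω, ‖f ω‖ ^ 2 ∂P := by
  have h := inner_toLp_eq_integral hf hf
  have e : ∀ ω, f ω * conj (f ω) = ((‖f ω‖ ^ 2 : ℝ) : ℂ) := fun ω => by
    rw [RCLike.mul_conj]; simp
  simp only [e] at h
  rw [integral_complex_ofReal, inner_self_eq_norm_sq_to_K] at h
  exact Complex.ofReal_injective (by push_cast; simpa using h)

lemma memLp_two_of_lintegral_sq_lt_top {f : Ω → ℂ} (hf : AEStronglyMeasurable f P)
    (h : ∫⁻ ω, ‖f ω‖ₑ ^ 2 ∂P < ∞) : MemLp f 2 P := by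
  rw [memLp_two_iff_integrable_sq_norm hf]
  refine ⟨hf.norm.pow 2, ?_⟩
  simpa [HasFiniteIntegral] using h

lemma norm_toLp_sq_le {f : Ω → ℂ} (hf : MemLp f 2 P) {c : ℝ} (hc : 0 ≤ c)
    (h : ∫⁻ ω, ‖f ω‖ₑ ^ 2 ∂P ≤ ENNReal.ofReal c) : ‖hf.toLp f‖ ^ 2 ≤ c := by
  rw [norm_toLp_sq_eq_integral, integral_eq_lintegral_of_nonneg_ae
    (.of_forall fun ω => by positivity) (by exact hf.1.norm.pow 2)]
  refine ENNReal.toReal_le_of_le_ofReal hc (le_trans (le_of_eq ?_) h)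
  congr 1
  ext ω
  rw [ENNReal.ofReal_pow (norm_nonneg _), ofReal_norm]

end HilbertSpace

lemma abs_sum_inv_sub_log_le {N : ℕ} (hN : 1 ≤ N) :
    |∑ k ∈ Finset.Ioc 0 N, (k : ℝ)⁻¹ - Real.log N| ≤ 1 := by
  have e : ∑ k ∈ Finset.Ioc 0 N, (k : ℝ)⁻¹ = (harmonic N : ℝ) := by
    rw [harmonic_eq_sum_Icc]
    push_cast
    rfl
  have hN0 : (0 : ℝ) < N := by exact_mod_cast hN
  have h1 := log_add_one_le_harmonic N
  have h2 := harmonic_le_one_add_log N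
  have h3 : Real.log N ≤ Real.log ((N + 1 : ℕ) : ℝ) :=
    Real.log_le_log hN0 (by push_cast; linarith)
  rw [e]
  exact abs_le.mpr ⟨by linarith, by linarith⟩

lemma tendsto_sqrt_log : Tendsto (fun n : ℕ => √(Real.log n)) atTop atTop :=
  Real.tendsto_sqrt_atTop.comp (Real.tendsto_log_atTop.comp tendsto_natCast_atTop_atTop)

section Walk

variable {Ω : Type*} [MeasurableSpace Ω] {P : Measure Ω} [IsProbabilityMeasure P]
  {X : ℕ → Ω → ℝ}

lemma memLp_zetaBlock (hlaw : ∀ i, HasLaw (X i) (cauchyMeasure 0 1) P) (n N : ℕ) :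
    MemLp (fun ω => zetaBlock 0 N (randomWalk X n ω)) 2 P := by
  obtain ⟨C, hC⟩ := exists_norm_zetaBlock_le 0 N
  exact MemLp.of_bound ((measurable_zetaBlock 0 N).comp_aemeasurable
    (aemeasurable_randomWalk hlaw n)).aestronglyMeasurable C (.of_forall fun ω => hC _)

lemma lintegral_zetaHalf_sub_zetaBlock_randomWalk_le (hindep : iIndepFun X P)
    (hlaw : ∀ i, HasLaw (X i) (cauchyMeasure 0 1) P) {n N : ℕ} (hn : 1 ≤ n) (hN : 1 ≤ N) :
    ∫⁻ ω, ‖zetaHalf (randomWalk X n ω) - zetaBlock 0 N (randomWalk X n ω)‖ₑ ^ 2 ∂P ≤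
      ENNReal.ofReal (2 * n / N) := by
  have hm : Measurable fun t => ‖zetaHalf t - zetaBlock 0 N t‖ₑ ^ 2 :=
    ((continuous_zetaHalf.measurable.sub (measurable_zetaBlock 0 N)).enorm).pow_const 2
  have := (hasLaw_randomWalk hindep hlaw n).lintegral_comp hm.aemeasurable
  rw [this]
  exact lintegral_zetaHalf_sub_zetaBlock_le hN hn

lemma memLp_zetaHalf_randomWalk (hindep : iIndepFun X P)
    (hlaw : ∀ i, HasLaw (X i) (cauchyMeasure 0 1) P) (n : ℕ) :
    MemLp (fun ω => zetaHalf (randomWalk X n ω)) 2 P := by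
  rcases Nat.eq_zero_or_pos n with rfl | hn
  · simpa [randomWalk] using memLp_const (zetaHalf 0)
  have h1 := memLp_zetaBlock hlaw n 1
  have hz : AEStronglyMeasurable (fun ω => zetaHalf (randomWalk X n ω)) P :=
    (continuous_zetaHalf.measurable.comp_aemeasurable
      (aemeasurable_randomWalk hlaw n)).aestronglyMeasurable
  have h2 := memLp_two_of_lintegral_sq_lt_top (hz.sub h1.1)
    ((lintegral_zetaHalf_sub_zetaBlock_randomWalk_le hindep hlaw hn le_rfl).trans_lt
      ENNReal.ofReal_lt_top)
  simpa using h2.add h1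

/-- The class of `ζ(1/2 + i S_n)` in `L²`. -/
noncomputable def zetaVec (hindep : iIndepFun X P)
    (hlaw : ∀ i, HasLaw (X i) (cauchyMeasure 0 1) P) (n : ℕ) : Lp ℂ 2 P :=
  (memLp_zetaHalf_randomWalk hindep hlaw n).toLp _

/-- The class in `L²` of the truncation at `N` evaluated at `S_n`. -/
noncomputable def blockVec (hlaw : ∀ i, HasLaw (X i) (cauchyMeasure 0 1) P) (n N : ℕ) :
    Lp ℂ 2 P :=
  (memLp_zetaBlock hlaw n N).toLp _

lemma norm_zetaVec_sub_blockVec_le (hindep : iIndepFun X P)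
    (hlaw : ∀ i, HasLaw (X i) (cauchyMeasure 0 1) P) {n N : ℕ} (hn : 1 ≤ n) (hN : 1 ≤ N) :
    ‖zetaVec hindep hlaw n - blockVec hlaw n N‖ ≤ √(2 * n / N) := by
  rw [zetaVec, blockVec, ← MemLp.toLp_sub]
  exact Real.le_sqrt_of_sq_le (norm_toLp_sq_le _ (by positivity)
    (lintegral_zetaHalf_sub_zetaBlock_randomWalk_le hindep hlaw hn hN))

lemma tendsto_blockVec (hindep : iIndepFun X P)
    (hlaw : ∀ i, HasLaw (X i) (cauchyMeasure 0 1) P) {n : ℕ} (hn : 1 ≤ n) :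
    Tendsto (blockVec hlaw n) atTop (𝓝 (zetaVec hindep hlaw n)) := by
  rw [tendsto_iff_norm_sub_tendsto_zero]
  have h : Tendsto (fun N : ℕ => √(2 * n / N)) atTop (𝓝 0) := by
    have := (tendsto_const_div_atTop_nhds_zero_nat (2 * n : ℝ)).sqrt
    simpa using this
  refine squeeze_zero' (.of_forall fun _ => norm_nonneg _) ?_ h
  filter_upwards [eventually_ge_atTop 1] with N hN
  rw [norm_sub_rev]
  exact norm_zetaVec_sub_blockVec_le hindep hlaw hn hN

/-- The values of the zeta function at the times `n` and `n + 2` have bounded correlation. -/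
lemma exists_norm_inner_zetaVec_le (hindep : iIndepFun X P)
    (hlaw : ∀ i, HasLaw (X i) (cauchyMeasure 0 1) P) :
    ∃ C : ℝ, ∀ n : ℕ, 1 ≤ n →
      ‖inner ℂ (zetaVec hindep hlaw n) (zetaVec hindep hlaw (n + 2))‖ ≤ C := by
  obtain ⟨C, hC⟩ := exists_norm_integral_zetaBlock_mul_conj_le hindep hlaw
  refine ⟨C, fun n hn => ?_⟩
  have h := ((tendsto_blockVec hindep hlaw hn).inner (𝕜 := ℂ)
    (tendsto_blockVec hindep hlaw (n := n + 2) (by omega))).norm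
  refine le_of_tendsto h (.of_forall fun N => ?_)
  rw [blockVec, blockVec, inner_toLp_eq_integral]
  exact hC n N hn

/-- Mean square of the zeta function along the walk, with truncation at `n L`. -/
lemma exists_abs_norm_zetaVec_sq_sub_log_le (hindep : iIndepFun X P)
    (hlaw : ∀ i, HasLaw (X i) (cauchyMeasure 0 1) P) (L : ℕ) (hL : 1 ≤ L) :
    ∃ K : ℝ, ∀ n : ℕ, 1 ≤ n →
      |‖zetaVec hindep hlaw n‖ ^ 2 - Real.log n| ≤ 2 * √(2 / L) * √(Real.log n) + K := by
  obtain ⟨C, hC⟩ := exists_abs_integral_norm_zetaBlock_sub_le hindep hlaw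
  -- `K₀` bounds the error in the mean square of the truncation at `n L`, `δ` the truncation error.
  set K₀ : ℝ := C * L ^ 2 + 9 * L + 1 + Real.log L
  set δ : ℝ := √(2 / L)
  refine ⟨K₀ + δ * (2 * √K₀ + δ), fun n hn => ?_⟩
  have hn0 : (0 : ℝ) < n := by exact_mod_cast hn
  have hL0 : (0 : ℝ) < L := by exact_mod_cast hL
  have hδ0 : 0 ≤ δ := Real.sqrt_nonneg _
  have hlog0 : 0 ≤ Real.log n := Real.log_natCast_nonneg n
  have hlogL : 0 ≤ Real.log L := Real.log_natCast_nonneg L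
  set z := zetaVec hindep hlaw n
  set a := blockVec hlaw n (n * L)
  have hza : ‖z - a‖ ≤ δ := by
    have := norm_zetaVec_sub_blockVec_le hindep hlaw hn (N := n * L) (Nat.mul_pos hn hL)
    have e : 2 * (n : ℝ) / (n * L : ℕ) = 2 / L := by
      push_cast
      field_simp
    rwa [e] at this
  have ha : |‖a‖ ^ 2 - Real.log n| ≤ K₀ := by
    have h1 := hC n (n * L) hn
    have e : ((n * L : ℕ) : ℝ) / n = L := by
      push_cast
      field_simp
    rw [e, ← norm_toLp_sq_eq_integral (memLp_zetaBlock hlaw n (n * L))] at h1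
    have h2 := abs_sum_inv_sub_log_le (N := n * L) (Nat.mul_pos hn hL)
    have h3 : Real.log ((n * L : ℕ) : ℝ) = Real.log n + Real.log L := by
      push_cast
      exact Real.log_mul hn0.ne' hL0.ne'
    rw [h3] at h2
    have h1' := abs_le.mp h1
    have h2' := abs_le.mp h2
    refine abs_le.mpr ⟨?_, ?_⟩
    · change _ ≤ ‖(memLp_zetaBlock hlaw n (n * L)).toLp _‖ ^ 2 - _
      linarith [h1'.1, h2'.1]
    · change ‖(memLp_zetaBlock hlaw n (n * L)).toLp _‖ ^ 2 - _ ≤ _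
      linarith [h1'.2, h2'.2]
  have hK0 : 0 ≤ K₀ := (abs_nonneg _).trans ha
  have hanorm : ‖a‖ ≤ √(Real.log n) + √K₀ := by
    refine abs_le_of_sq_le_sq' ?_ (by positivity) |>.2
    nlinarith [(abs_le.mp ha).2, Real.sq_sqrt hlog0, Real.sq_sqrt hK0,
      mul_nonneg (Real.sqrt_nonneg (Real.log n)) (Real.sqrt_nonneg K₀)]
  have hdiff : |‖z‖ - ‖a‖| ≤ δ := (abs_norm_sub_norm_le z a).trans hza
  have hsq : |‖z‖ ^ 2 - ‖a‖ ^ 2| ≤ δ * (2 * (√(Real.log n) + √K₀) + δ) := by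
    have e : ‖z‖ ^ 2 - ‖a‖ ^ 2 = (‖z‖ - ‖a‖) * (‖z‖ + ‖a‖) := by ring
    rw [e, abs_mul, abs_of_nonneg (by positivity : 0 ≤ ‖z‖ + ‖a‖)]
    exact mul_le_mul hdiff (by linarith [(abs_le.mp hdiff).2]) (by positivity) hδ0
  calc |‖z‖ ^ 2 - Real.log n| = |(‖z‖ ^ 2 - ‖a‖ ^ 2) + (‖a‖ ^ 2 - Real.log n)| := by ring_nf
    _ ≤ |‖z‖ ^ 2 - ‖a‖ ^ 2| + |‖a‖ ^ 2 - Real.log n| := abs_add_le _ _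
    _ ≤ δ * (2 * (√(Real.log n) + √K₀) + δ) + K₀ := add_le_add hsq ha
    _ = _ := by ring

/-- Letting `L → ∞` after `n → ∞`, the mean square of the zeta function is `log n + o(√(log n))`. -/
lemma isLittleO_norm_zetaVec_sq_sub_log (hindep : iIndepFun X P)
    (hlaw : ∀ i, HasLaw (X i) (cauchyMeasure 0 1) P) :
    (fun n : ℕ => ‖zetaVec hindep hlaw n‖ ^ 2 - Real.log n) =o[atTop]
      fun n : ℕ => √(Real.log n) := by
  rw [isLittleO_iff]
  intro ε hε
  obtain ⟨L, hL1, hL⟩ : ∃ L : ℕ, 1 ≤ L ∧ 2 * √(2 / L) ≤ ε / 2 := by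
    have h : Tendsto (fun L : ℕ => 2 * √((2 : ℝ) / L)) atTop (𝓝 0) := by
      have := ((tendsto_const_div_atTop_nhds_zero_nat (2 : ℝ)).sqrt).const_mul 2
      simpa using this
    obtain ⟨L, h1, h2⟩ := ((eventually_ge_atTop 1).and
      (h.eventually (ge_mem_nhds (by positivity : 0 < ε / 2)))).exists
    exact ⟨L, h1, h2⟩
  obtain ⟨K, hK⟩ := exists_abs_norm_zetaVec_sq_sub_log_le hindep hlaw L hL1
  filter_upwards [eventually_ge_atTop 1,
    tendsto_sqrt_log.eventually_ge_atTop (K / (ε / 2))] with n hn hnK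
  rw [Real.norm_eq_abs, Real.norm_of_nonneg (Real.sqrt_nonneg _)]
  rw [div_le_iff₀ (by positivity)] at hnK
  have := mul_le_mul_of_nonneg_right hL (Real.sqrt_nonneg (Real.log n))
  linarith [hK n hn]

end Walk

lemma isBigO_log_add_two :
    (fun n : ℕ => √(Real.log ((n + 2 : ℕ) : ℝ))) =O[atTop] fun n : ℕ => √(Real.log n) := by
  refine IsBigO.of_bound (√2) ?_
  filter_upwards [eventually_ge_atTop 2] with n hn
  have hn' : (2 : ℝ) ≤ n := by exact_mod_cast hn
  rw [Real.norm_of_nonneg (Real.sqrt_nonneg _), Real.norm_of_nonneg (Real.sqrt_nonneg _),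
    ← Real.sqrt_mul (by norm_num)]
  refine Real.sqrt_le_sqrt ?_
  rw [show 2 * Real.log (n : ℝ) = Real.log ((n : ℝ) ^ 2) by rw [Real.log_pow]; norm_num]
  refine Real.log_le_log (by positivity) ?_
  push_cast
  nlinarith

lemma isLittleO_of_norm_le_sqrt_log {E : Type*} [NormedAddCommGroup E] {f : ℕ → E} {C : ℝ}
    (h : ∀ n, 1 ≤ n → ‖f n‖ ≤ C) : f =o[atTop] fun n : ℕ => √(Real.log n) := by
  have h1 : f =O[atTop] fun _ => (1 : ℝ) := by
    refine IsBigO.of_bound C ?_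
    filter_upwards [eventually_ge_atTop 1] with n hn
    simpa using h n hn
  refine h1.trans_isLittleO ((isLittleO_const_left_of_ne one_ne_zero).mpr ?_)
  exact tendsto_norm_atTop_atTop.comp tendsto_sqrt_log

lemma abs_log_add_two_sub_log_le {n : ℕ} (hn : 1 ≤ n) :
    ‖Real.log ((n + 2 : ℕ) : ℝ) - Real.log n‖ ≤ 2 := by
  have hn' : (1 : ℝ) ≤ n := by exact_mod_cast hn
  rw [← Real.log_div (by positivity) (by positivity)]
  have h1 : (1 : ℝ) ≤ ((n + 2 : ℕ) : ℝ) / n := by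
    rw [le_div_iff₀ (by positivity)]; push_cast; linarith
  rw [Real.norm_of_nonneg (Real.log_nonneg h1)]
  refine (Real.log_le_sub_one_of_pos (by positivity)).trans ?_
  push_cast
  rw [sub_le_iff_le_add, div_le_iff₀ (by positivity)]
  linarith

theorem proposition5p3 {Ω : Type*} [MeasurableSpace Ω] (P : Measure Ω) [IsProbabilityMeasure P]
    (X : ℕ → Ω → ℝ) (hindep : iIndepFun X P)
    (hlaw : ∀ i, HasLaw (X i) (cauchyMeasure 0 1) P) :
    (∀ n : ℕ, MemLp (fun ω => zetaHalf (randomWalk X n ω)) 2 P) ∧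
    (fun n : ℕ => ∫ ω, ‖zetaHalf (randomWalk X n ω)‖ ^ 2 ∂P)
      =O[atTop] (fun n : ℕ => Real.log (n : ℝ)) ∧
    (fun n : ℕ =>
        (∫ ω, ‖zetaHalf (randomWalk X (n + 2) ω) - zetaHalf (randomWalk X n ω)‖ ^ 2 ∂P)
          - 2 * Real.log (n : ℝ))
      =o[atTop] (fun n : ℕ => Real.sqrt (Real.log (n : ℝ))) := by
  have hmem := memLp_zetaHalf_randomWalk hindep hlaw
  have hmain := isLittleO_norm_zetaVec_sq_sub_log hindep hlaw
  refine ⟨hmem, ?_, ?_⟩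
  · have hsq : (fun n : ℕ => √(Real.log n)) =O[atTop] fun n : ℕ => Real.log n := by
      refine IsBigO.of_bound 1 ?_
      filter_upwards [tendsto_sqrt_log.eventually_ge_atTop 1] with n hn
      have hlog := Real.log_natCast_nonneg n
      rw [Real.norm_of_nonneg (Real.sqrt_nonneg _), Real.norm_of_nonneg hlog, one_mul]
      calc √(Real.log n) ≤ √(Real.log n) * √(Real.log n) :=
            le_mul_of_one_le_left (Real.sqrt_nonneg _) hn
        _ = Real.log n := Real.mul_self_sqrt hlog
    have := (hmain.isBigO.trans hsq).add (isBigO_refl (fun n : ℕ => Real.log (n : ℝ)) atTop)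
    refine this.congr_left fun n => ?_
    rw [sub_add_cancel]
    exact norm_toLp_sq_eq_integral (hmem n)
  · obtain ⟨C, hC⟩ := exists_norm_inner_zetaVec_le hindep hlaw
    have h1 : (fun n : ℕ => ‖zetaVec hindep hlaw (n + 2)‖ ^ 2 - Real.log ((n + 2 : ℕ) : ℝ)) =o[atTop]
        fun n : ℕ => √(Real.log n) :=
      (hmain.comp_tendsto (tendsto_add_atTop_nat 2)).trans_isBigO isBigO_log_add_two
    have h2 : (fun n : ℕ => Real.log ((n + 2 : ℕ) : ℝ) - Real.log n) =o[atTop]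
        fun n : ℕ => √(Real.log n) :=
      isLittleO_of_norm_le_sqrt_log fun n hn => abs_log_add_two_sub_log_le hn
    have h3 : (fun n : ℕ => (inner ℂ (zetaVec hindep hlaw n) (zetaVec hindep hlaw (n + 2))).re)
        =o[atTop] fun n : ℕ => √(Real.log n) :=
      isLittleO_of_norm_le_sqrt_log fun n hn => (Complex.abs_re_le_norm _).trans (hC n hn)
    refine (((h1.add h2).add hmain).sub (h3.const_mul_left 2)).congr_left fun n => ?_
    have e1 : ∫ ω, ‖zetaHalf (randomWalk X (n + 2) ω) - zetaHalf (randomWalk X n ω)‖ ^ 2 ∂P =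
        ‖zetaVec hindep hlaw n - zetaVec hindep hlaw (n + 2)‖ ^ 2 := by
      rw [norm_sub_rev, zetaVec, zetaVec, ← MemLp.toLp_sub, norm_toLp_sq_eq_integral]
      rfl
    rw [e1, @norm_sub_sq ℂ]
    simp only [RCLike.re_to_complex]
    ring
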